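/- **Setting.** Let $X$ (landmark states) be a measurable space with measurable diagonal and a $\sigma$-finite reference measure $d\theta$ for which single points are null sets, and let $Y$ (single measurements) be a measurable space with a reference measure $dz$. Write $\langle f;h\rangle=\int f(\theta)h(\theta)\,d\theta$. Random finite sets are described by their densities on finite sets, with set integral $\int\tau(\Theta)\,\delta\Theta=\sum_{n\ge 0}\frac1{n!}\int\tau(\{\theta_1,\dots,\theta_n\})\,d\theta_1\cdots d\theta_n$. A Poisson point process (PPP) with rate $\lambda\ge0$ and spatial density $f$ has density $e^{-\lambda}\prod_{\theta\in\Theta}\lambda f(\theta)$. A Bernoulli set with parameters $r,f$ has density $1-r$ at $\emptyset$, $r f(\theta)$ at $\{\theta\}$, and $0$ otherwise. The union of two independent random finite sets with densities $f_1,f_2$ has density $\sum_{\Theta_1\subseteq\Theta}f_1(\Theta_1)f_2(\Theta\setminus\Theta_1)$. **Model.** The map $\Theta$ has a PPP prior with rate $\lambda_0^u\ge 0$ and spatial probability density $f_0^u$. Given $\Theta$, the measurement sets $\mathbf Z_1,\dots,\mathbf Z_K\subset Y$ are independent, and $\mathbf Z_k$ is the union of independent sets: a clutter PPP with rate $\lambda_c\ge0$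 and spatial probability density $c$; and, for each $\theta\in\Theta$, a set that is empty with probability $1-p_D^k(\theta)$ and with probability $p_D^k(\theta)\in[0,1]$ is a PPP with rate $\gamma_k(\theta)\ge0$ and spatial probability density $\phi(\cdot\mid\theta)$. All functions are measurable. Let $f_0$ be the prior density and $p(\mathbf Z_k\mid\Theta)$ the resulting set likelihoods, and suppose that the finite sets $\mathbf Z_1,\dots,\mathbf Z_K$ are such that $0<\int f_0(\Theta)\prod_k p(\mathbf Z_k\mid\Theta)\,\delta\Theta<\infty$. The batch posterior density is $$f(\Theta\mid \mathbf Z)=\frac{f_0(\Theta)\prod_{k}p(\mathbf Z_k\mid\Theta)}{\int f_0(\Theta')\prod_{k}p(\mathbf Z_k\mid\Theta')\,\delta\Theta'} .$$ **Parameters.** Let $\mathbf Z$ be the disjoint union of the $\mathbf Z_k$ (measurements carry their time tag), let $j$ run over all partitions of $\mathbf Z$ into non-empty cells $\mathbf C^{j,i}$, $1\le i\le I^j$, and let $\mathbf V_k^{j,i}$ be the part of $\mathbf C^{j,i}$ with time tag $k$. Put $q_D^k(\theta)=1-p_D^k(\theta)+p_D^k(\theta)e^{-\gamma_k(\theta)}$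 and $$l_k^{j,i}(\theta)=\begin{cases}p_D^k(\theta)e^{-\gamma_k(\theta)}\prod_{z\in \mathbf V_k^{j,i}}\gamma_k(\theta)\phi(z\mid\theta),&\mathbf V_k^{j,i}\ne\emptyset,\\ q_D^k(\theta),&\mathbf V_k^{j,i}=\emptyset,\end{cases}\qquad L^{j,i}=\lambda_0^u\Big\langle f_0^u;\prod_{k=1}^K l_k^{j,i}\Big\rangle,$$ $$f^{j,i}(\theta)=\frac{f_0^u(\theta)\prod_k l_k^{j,i}(\theta)}{\langle f_0^u;\prod_k l_k^{j,i}\rangle},\qquad r^{j,i}=\begin{cases}\frac{L^{j,i}}{\lambda_c c(z)+L^{j,i}},&\mathbf C^{j,i}=\{z\},\\ 1,&|\mathbf C^{j,i}|>1,\end{cases}\qquad \mathcal L^{j,i}=\begin{cases}\lambda_c c(z)+L^{j,i},&\mathbf C^{j,i}=\{z\},\\ L^{j,i},&|\mathbf C^{j,i}|>1,\end{cases}$$ $$W^j=\frac{\prod_i\mathcal L^{j,i}}{\sum_{j'}\prod_i\mathcal L^{j',i}},\qquad \lambda^u_K=\lambda_0^u\Big\langle f_0^u;\prod_k q_D^k\Big\rangle,\qquad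 f^u_K(\theta)=\frac{f_0^u(\theta)\prod_k q_D^k(\theta)}{\langle f_0^u;\prod_k q_D^k\rangle}.$$ Quotients with zero denominator and divergent integrals $\langle\cdot;\cdot\rangle$ are read as $0$. **Theorem.** The batch posterior is a Poisson multi-Bernoulli mixture: $$f(\Theta\mid\mathbf Z)=\sum_{\Theta^d\subseteq\Theta}\Big(\sum_j W^j\sum_{\alpha}\prod_{i=1}^{I^j}f^{j,i}(\Theta_{\alpha(i)})\Big)\Big(e^{-\lambda_K^u}\prod_{\theta\in\Theta\setminus\Theta^d}\lambda_K^u f_K^u(\theta)\Big),$$ where $\alpha$ runs over the maps from $\{1,\dots,I^j\}$ to $\{\text{none}\}\cup\Theta^d$ that hit every element of $\Theta^d$ exactly once, $\Theta_{\alpha(i)}$ is $\emptyset$ if $\alpha(i)=\text{none}$ and $\{\alpha(i)\}$ otherwise, and $f^{j,i}(\cdot)$, applied to sets, is the Bernoulli density with parameters $r^{j,i},f^{j,i}$. The identity holds for all finite $\Theta\subset X\setminus N$, where $N\subset X$ is a null set, which is empty if $\langle f_0^u;\prod_k q_D^k\rangle$ and, for all non-empty cells $\mathbf C\subseteq\mathbf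 Z$, the denominators of the cell densities are non-zero (and not divergent). Moreover the parameters are proper: $W^j\ge0$, $\sum_jW^j=1$, $0\le r^{j,i}\le1$, $f^{j,i}$ is a probability density whenever $W^j\ne0$ and $r^{j,i}\ne0$; $\lambda_K^u\ge0$, and $f_K^u$ is a probability density whenever $\lambda_K^u\neq0$. -/

import Mathlib

open MeasureTheory
open scoped ENNReal

noncomputable section

namespace PMBM

/-! ## Densities of random finite sets

A random finite set (RFS) on `X` is described by its density, a function of finite sets
`Finset X → ℝ`, relative to a diffuse reference measure on `X`. -/

/-- `f` is a probability density with respect to `μ`. -/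
structure IsProbDensity {X : Type*} [MeasurableSpace X] (f : X → ℝ) (μ : Measure X) : Prop where
  measurable : Measurable f
  nonneg : ∀ x, 0 ≤ f x
  integral_eq_one : ∫ x, f x ∂μ = 1

/-- The pairing `⟨f; h⟩ = ∫ f(x) h(x) dx`. -/
def pairing {X : Type*} [MeasurableSpace X] (μ : Measure X) (f h : X → ℝ) : ℝ :=
  ∫ x, f x * h x ∂μ

/-- The set integral of a nonnegative function of finite sets,
`∫ τ(Θ) δΘ = ∑ₙ (1 / n!) ∫ τ({θ₁, …, θₙ}) dθ₁ … dθₙ` (the term `n = 0` is `τ(∅)`). -/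
def setLIntegral {X : Type*} [MeasurableSpace X] [DecidableEq X] (μ : Measure X)
    (τ : Finset X → ℝ≥0∞) : ℝ≥0∞ :=
  ∑' n : ℕ, ((n.factorial : ℝ≥0∞))⁻¹ *
    ∫⁻ θ : Fin n → X, τ (Finset.univ.image θ) ∂(Measure.pi fun _ => μ)

/-- RFS density of a Poisson point process with rate `lam` and spatial density `f`. -/
def pppDensity {X : Type*} (lam : ℝ) (f : X → ℝ) (Θ : Finset X) : ℝ :=
  Real.exp (-lam) * ∏ θ ∈ Θ, lam * f θ

/-- RFS density of a Bernoulli RFS with existence probability `r` and spatial density `f`: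
`1 - r` at `∅`, `r f(θ)` at `{θ}`, and `0` otherwise. -/
def bernoulliDensity {X : Type*} [DecidableEq X] (r : ℝ) (f : X → ℝ) (Θ : Finset X) : ℝ :=
  if Θ = ∅ then 1 - r else if Θ.card = 1 then r * ∏ θ ∈ Θ, f θ else 0

/-- RFS density of the union of two independent RFSs with densities `f` and `g`. -/
def unionDensity {X : Type*} [DecidableEq X] (f g : Finset X → ℝ) (Θ : Finset X) : ℝ :=
  ∑ Θ₁ ∈ Θ.powerset, f Θ₁ * g (Θ \ Θ₁)

/-- RFS density of the union of a finite family of independent RFSs with densities `f i`: the sum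
over all ways to attribute each point of `Θ` to a member of the family. -/
def unionFamilyDensity {X ι : Type*} [DecidableEq X] [Fintype ι] [DecidableEq ι]
    (f : ι → Finset X → ℝ) (Θ : Finset X) : ℝ :=
  ∑ a : Θ → ι, ∏ i, f i ((Finset.univ.filter fun θ : Θ => a θ = i).image Subtype.val)

/-- The maps `α` that send each Bernoulli component `i` either to nothing (`none`) or to an element
of `Θ`, such that every element of `Θ` is hit and no element is hit twice. -/
def IsAssignment {X ι : Type*} {Θ : Finset X} (α : ι → Option Θ) : Prop :=
  (∀ θ : Θ, ∃ i, α i = some θ) ∧ ∀ i l, α i ≠ none → i ≠ l → α i ≠ α l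

/-- The set `Θ_{α(i)}`: empty if `α i = none`, and `{θ}` if `α i = some θ`. -/
def assigned {X : Type*} {Θ : Finset X} : Option Θ → Finset X
  | none => ∅
  | some θ => {(θ : X)}

open Classical in
/-- RFS density of a multi-Bernoulli RFS with Bernoulli parameters `r i`, `f i`. -/
def mbDensity {X ι : Type*} [DecidableEq X] [Fintype ι] (r : ι → ℝ) (f : ι → X → ℝ)
    (Θ : Finset X) : ℝ :=
  ∑ α : ι → Option Θ with IsAssignment α, ∏ i, bernoulliDensity (r i) (f i) (assigned (α i))

/-- RFS density of a multi-Bernoulli mixture with weights `W j`. -/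
def mbmDensity {X J : Type*} [DecidableEq X] [Fintype J] {ι : J → Type*} [∀ j, Fintype (ι j)]
    (W : J → ℝ) (r : ∀ j, ι j → ℝ) (f : ∀ j, ι j → X → ℝ) (Θ : Finset X) : ℝ :=
  ∑ j, W j * mbDensity (r j) (f j) Θ

/-- RFS density of a Poisson multi-Bernoulli mixture: the union of an independent MBM and PPP. -/
def pmbmDensity {X J : Type*} [DecidableEq X] [Fintype J] {ι : J → Type*} [∀ j, Fintype (ι j)]
    (lam : ℝ) (fu : X → ℝ) (W : J → ℝ) (r : ∀ j, ι j → ℝ) (f : ∀ j, ι j → X → ℝ)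
    (Θ : Finset X) : ℝ :=
  unionDensity (mbmDensity W r f) (pppDensity lam fu) Θ

/-! ## Measurement model -/

/-- Parameters of the standard Poisson extended-object measurement model with Poisson clutter over
`K` time steps; `X` is the space of landmark states and `Y` the space of measurements. -/
structure MeasurementModel (K : ℕ) (X Y : Type*) [MeasurableSpace X] [MeasurableSpace Y]
    (ν : Measure Y) where
  /-- probability of detection `p_D^k(θ)` -/
  pD : Fin K → X → ℝ
  pD_measurable : ∀ k, Measurable (pD k)
  pD_nonneg : ∀ k θ, 0 ≤ pD k θ
  pD_le_one : ∀ k θ, pD k θ ≤ 1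
  /-- Poisson rate `γ_k(θ)` of the number of measurements of a detected landmark -/
  γ : Fin K → X → ℝ
  γ_measurable : ∀ k, Measurable (γ k)
  γ_nonneg : ∀ k θ, 0 ≤ γ k θ
  /-- spatial density `φ(z | θ)` of a landmark measurement -/
  φ : Y → X → ℝ
  φ_measurable : Measurable (Function.uncurry φ)
  φ_density : ∀ θ, IsProbDensity (fun z => φ z θ) ν
  /-- clutter rate `λ_c` -/
  lamC : ℝ
  lamC_nonneg : 0 ≤ lamC
  /-- clutter spatial density `c(z)` -/
  c : Y → ℝ
  c_density : IsProbDensity c ν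

section model

variable {K : ℕ} {X Y : Type*} [MeasurableSpace X] [MeasurableSpace Y] {ν : Measure Y}

/-- RFS density at time `k` of the set of measurements generated by one landmark with state `θ`:
empty with probability `1 - p_D`, a PPP with rate `γ` and density `φ(· | θ)` with probability
`p_D`. -/
def landmarkDensity [DecidableEq Y] (M : MeasurementModel K X Y ν) (k : Fin K) (θ : X)
    (V : Finset Y) : ℝ :=
  (1 - M.pD k θ) * (if V = ∅ then 1 else 0)
    + M.pD k θ * pppDensity (M.γ k θ) (fun z => M.φ z θ) V

/-- The likelihood `p(Z_k | Θ)`: RFS density of the union of the clutter PPP and the measurement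
sets generated independently by the landmarks in `Θ`. -/
def stepLikelihood [DecidableEq X] [DecidableEq Y] (M : MeasurementModel K X Y ν) (k : Fin K)
    (Θ : Finset X) (Zk : Finset Y) : ℝ :=
  unionDensity (pppDensity M.lamC M.c)
    (unionFamilyDensity fun θ : Θ => landmarkDensity M k (θ : X)) Zk

/-- The joint density `f₀(Θ) ∏ₖ p(Z_k | Θ)` of map and measurements, for a PPP prior on the map with
rate `lam0` and spatial density `f0`. -/
def jointDensity [DecidableEq X] [DecidableEq Y] (M : MeasurementModel K X Y ν) (lam0 : ℝ)
    (f0 : X → ℝ) (Z : Fin K → Finset Y) (Θ : Finset X) : ℝ :=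
  pppDensity lam0 f0 Θ * ∏ k, stepLikelihood M k Θ (Z k)

/-- The density of the measurement batch, `∫ f₀(Θ) ∏ₖ p(Z_k | Θ) δΘ`. -/
def evidence [DecidableEq X] [DecidableEq Y] (μ : Measure X) (M : MeasurementModel K X Y ν)
    (lam0 : ℝ) (f0 : X → ℝ) (Z : Fin K → Finset Y) : ℝ≥0∞ :=
  setLIntegral μ fun Θ => ENNReal.ofReal (jointDensity M lam0 f0 Z Θ)

/-- The batch posterior RFS density `f(Θ | Z)` of the map, by Bayes' rule. -/
def posteriorDensity [DecidableEq X] [DecidableEq Y] (μ : Measure X)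
    (M : MeasurementModel K X Y ν) (lam0 : ℝ) (f0 : X → ℝ) (Z : Fin K → Finset Y)
    (Θ : Finset X) : ℝ :=
  jointDensity M lam0 f0 Z Θ / (evidence μ M lam0 f0 Z).toReal

/-! ## Parameters of the posterior -/

/-- The full set of (time-tagged) measurements, the disjoint union of the sets `Z k`. -/
def batch (Z : Fin K → Finset Y) : Finset (Σ _ : Fin K, Y) :=
  Finset.univ.sigma Z

/-- The measurements with time tag `k` in a cell. -/
def cellAt [DecidableEq Y] (C : Finset (Σ _ : Fin K, Y)) (k : Fin K) : Finset Y :=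
  (C.filter fun z => z.1 = k).image fun z => z.2

/-- Effective probability of missed detection `q_D^k(θ) = 1 - p_D^k(θ) + p_D^k(θ) e^{-γ_k(θ)}`. -/
def qD (M : MeasurementModel K X Y ν) (k : Fin K) (θ : X) : ℝ :=
  1 - M.pD k θ + M.pD k θ * Real.exp (-M.γ k θ)

/-- The likelihood `l_k(θ)` of the part of cell `C` with time tag `k`. -/
def cellStepLikelihood [DecidableEq Y] (M : MeasurementModel K X Y ν)
    (C : Finset (Σ _ : Fin K, Y)) (k : Fin K) (θ : X) : ℝ :=
  if cellAt C k = ∅ then qD M k θ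
  else M.pD k θ * Real.exp (-M.γ k θ) * ∏ z ∈ cellAt C k, M.γ k θ * M.φ z θ

/-- `⟨f₀; ∏ₖ l_k⟩` for the cell `C`. -/
def cellMass [DecidableEq Y] (μ : Measure X) (M : MeasurementModel K X Y ν) (f0 : X → ℝ)
    (C : Finset (Σ _ : Fin K, Y)) : ℝ :=
  pairing μ f0 fun θ => ∏ k, cellStepLikelihood M C k θ

/-- `L = λ₀ ⟨f₀; ∏ₖ l_k⟩` for the cell `C`. -/
def cellL [DecidableEq Y] (μ : Measure X) (M : MeasurementModel K X Y ν) (lam0 : ℝ) (f0 : X → ℝ)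
    (C : Finset (Σ _ : Fin K, Y)) : ℝ :=
  lam0 * cellMass μ M f0 C

/-- Clutter intensity `λ_c c(z)` at the measurement of a one-element cell `C = {z}`. -/
def cellClutter (M : MeasurementModel K X Y ν) (C : Finset (Σ _ : Fin K, Y)) : ℝ :=
  ∏ z ∈ C, M.lamC * M.c z.2

/-- Spatial density of the Bernoulli component of the cell `C`. -/
def cellSpatial [DecidableEq Y] (μ : Measure X) (M : MeasurementModel K X Y ν) (f0 : X → ℝ)
    (C : Finset (Σ _ : Fin K, Y)) (θ : X) : ℝ :=
  f0 θ * (∏ k, cellStepLikelihood M C k θ) / cellMass μ M f0 C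

/-- Existence probability of the Bernoulli component of the (non-empty) cell `C`. -/
def cellExistence [DecidableEq Y] (μ : Measure X) (M : MeasurementModel K X Y ν) (lam0 : ℝ)
    (f0 : X → ℝ) (C : Finset (Σ _ : Fin K, Y)) : ℝ :=
  if C.card = 1 then cellL μ M lam0 f0 C / (cellClutter M C + cellL μ M lam0 f0 C) else 1

/-- Likelihood of the (non-empty) cell `C`. -/
def cellLikelihood [DecidableEq Y] (μ : Measure X) (M : MeasurementModel K X Y ν) (lam0 : ℝ)
    (f0 : X → ℝ) (C : Finset (Σ _ : Fin K, Y)) : ℝ :=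
  if C.card = 1 then cellClutter M C + cellL μ M lam0 f0 C else cellL μ M lam0 f0 C

/-- Weight of the mixture component of the partition `P` of the measurements: the product of the
likelihoods of its cells, normalized over all partitions. -/
def weight [DecidableEq Y] (μ : Measure X) (M : MeasurementModel K X Y ν) (lam0 : ℝ)
    (f0 : X → ℝ) (Z : Fin K → Finset Y) (P : Finpartition (batch Z)) : ℝ :=
  (∏ C ∈ P.parts, cellLikelihood μ M lam0 f0 C) /
    ∑ Q : Finpartition (batch Z), ∏ C ∈ Q.parts, cellLikelihood μ M lam0 f0 C

/-- `⟨f₀; ∏ₖ q_D^k⟩`. -/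
def undetectedMass (μ : Measure X) (M : MeasurementModel K X Y ν) (f0 : X → ℝ) : ℝ :=
  pairing μ f0 fun θ => ∏ k, qD M k θ

/-- Rate of the PPP of undetected landmarks. -/
def undetectedRate (μ : Measure X) (M : MeasurementModel K X Y ν) (lam0 : ℝ) (f0 : X → ℝ) : ℝ :=
  lam0 * undetectedMass μ M f0

/-- Spatial density of the PPP of undetected landmarks. -/
def undetectedSpatial (μ : Measure X) (M : MeasurementModel K X Y ν) (f0 : X → ℝ) (θ : X) : ℝ :=
  f0 θ * (∏ k, qD M k θ) / undetectedMass μ M f0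

end model

end PMBM

end

/-! Multiplying out prior and likelihoods turns the joint density into a positive constant times a
sum over attributions of the tagged measurements to clutter or to landmarks of `Θ`
(`jointDensity_eq_attributionSum`). A clutter point contributes `λ_c c(z)`; a landmark with
measurements `C`, possibly none, contributes `λ₀ f₀(θ) ∏ₖ l_k(θ)`.

An attribution is the same as a partition of the batch together with a partial injection from its
cells to the landmarks: points of a common landmark form a cell, and each clutter point is a cell of
its own. Hence unassigned cells must be singletons (`attributionSum_withClutter`). The PMBM density
is also a sum over partitions and partial injections, with the unhit landmarks forming the Poisson
part (`unionDensity_mbDensity`). The two sums agree cell by cell, since likelihood times Bernoulli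
density is the factor of the cell (`cellLikelihood_mul_bernoulliDensity`).

For the normalization, integrate over `n` ordered landmarks, almost surely distinct. The integrals
factor, so only the number of partial injections with a given domain matters. The weights `1 / n!`
turn this number into an exponential series that does not depend on the domain
(`tsum_inv_factorial_mul_descFactorial`). The evidence is therefore a constant times `exp (L_∅)`
times the sum over partitions of the products of cell likelihoods.

Cell integrals may diverge, so the evidence is computed in `ℝ≥0∞`. If it is finite, every product
over a partition is finite, so an infinite factor only occurs beside a zero factor; reading it as
`0` is then harmless. Division by a zero mass fails only on the null set `exceptionalSet`. -/

noncomputable section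

namespace PMBM

/-! ### Attributions of points to sources -/

section attribution

variable {β ι κ R : Type*} [DecidableEq β] [DecidableEq ι] [DecidableEq κ]

/-- The set of points of `s` that the attribution `a` sends to `i`. -/
def fiber {s : Finset β} (a : s → ι) (i : ι) : Finset β :=
  (Finset.univ.filter fun z : s => a z = i).image Subtype.val

lemma mem_fiber {s : Finset β} {a : s → ι} {i : ι} {z : β} :
    z ∈ fiber a i ↔ ∃ h : z ∈ s, a ⟨z, h⟩ = i := by
  simp [fiber]

lemma fiber_subset {s : Finset β} (a : s → ι) (i : ι) : fiber a i ⊆ s := fun _ hz =>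
  (mem_fiber.1 hz).1

lemma prod_fiber {M : Type*} [CommMonoid M] {s : Finset β} (a : s → ι) (i : ι) (g : β → M) :
    ∏ z ∈ fiber a i, g z = ∏ z : s, if a z = i then g z else 1 := by
  rw [fiber, Finset.prod_image (fun _ _ _ _ h => Subtype.ext h), Finset.prod_filter]

variable [Fintype ι] [Fintype κ] [CommSemiring R]

/-- Sum over all ways to attribute each point of `s` to a member of the family `f`, for values in an
arbitrary semiring. -/
def attributionSum (f : ι → Finset β → R) (s : Finset β) : R :=
  ∑ a : s → ι, ∏ i, f i (fiber a i)

lemma unionFamilyDensity_eq_attributionSum (f : ι → Finset β → ℝ) :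
    unionFamilyDensity f = attributionSum f := rfl

lemma attributionSum_comp_equiv (e : ι ≃ κ) (f : κ → Finset β → R) (s : Finset β) :
    attributionSum (fun i => f (e i)) s = attributionSum f s := by
  refine Fintype.sum_equiv ((Equiv.refl s).arrowCongr e) _ _ fun a => ?_
  refine Fintype.prod_equiv e _ _ fun i => ?_
  congr 1
  ext z
  simp [mem_fiber]

/-- The subset given to the first set in the binary union is the fiber over `none`; the rest is
attributed within the family. -/
lemma unionDensity_unionFamilyDensity (f : Option ι → Finset β → ℝ) (s : Finset β) :
    unionDensity (f none) (unionFamilyDensity fun i => f (some i)) s = attributionSum f s := by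
  classical
  unfold unionDensity attributionSum
  rw [← Finset.sum_fiberwise_of_maps_to (s := (Finset.univ : Finset (s → Option ι)))
    (t := s.powerset) (g := fun b => fiber b none)
    (fun b _ => Finset.mem_powerset.2 (fiber_subset b none))]
  refine Finset.sum_congr rfl fun A hA => ?_
  rw [unionFamilyDensity_eq_attributionSum, attributionSum, Finset.mul_sum]
  have hAs := Finset.mem_powerset.1 hA
  refine Finset.sum_bij'
    (fun a _ => fun z : s => if h : (z : β) ∈ A then none
      else some (a ⟨z, Finset.mem_sdiff.2 ⟨z.2, h⟩⟩))
    (fun b hb => fun z => (b ⟨z, (Finset.mem_sdiff.1 z.2).1⟩).get (by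
      rw [Option.isSome_iff_ne_none]
      intro h
      exact (Finset.mem_sdiff.1 z.2).2
        ((Finset.ext_iff.1 (Finset.mem_filter.1 hb).2 _).1 (mem_fiber.2 ⟨_, h⟩))))
    ?_ ?_ ?_ ?_ ?_
  · intro a _
    refine Finset.mem_filter.2 ⟨Finset.mem_univ _, ?_⟩
    ext z
    simp only [mem_fiber, dite_eq_left_iff, reduceCtorEq, imp_false, not_not]
    exact ⟨fun h => h.2, fun h => ⟨hAs h, h⟩⟩
  · intro b _
    exact Finset.mem_univ _
  · intro a _
    ext z
    simp [(Finset.mem_sdiff.1 z.2).2]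
  · intro b hb
    have hb' : fiber b none = A := (Finset.mem_filter.1 hb).2
    funext z
    by_cases h : (z : β) ∈ A
    · have h' := h
      rw [← hb', mem_fiber] at h'
      simp [h, h'.2]
    · simp [h]
  · intro a _
    rw [Fintype.prod_option]
    congr 1
    · congr 1
      ext z
      simp only [mem_fiber, dite_eq_left_iff, reduceCtorEq, imp_false, not_not]
      exact ⟨fun h => ⟨hAs h, h⟩, fun h => h.2⟩
    · refine Finset.prod_congr rfl fun i _ => ?_
      congr 1
      ext z
      simp only [mem_fiber, Finset.mem_sdiff]
      constructor
      · rintro ⟨h, rfl⟩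
        exact ⟨h.1, by simp [h.2]⟩
      · rintro ⟨h, h2⟩
        split_ifs at h2 with h3
        exact ⟨⟨h, h3⟩, by simpa using h2⟩

lemma mem_cellAt {K : ℕ} {C : Finset (Σ _ : Fin K, β)} {k : Fin K} {z : β} :
    z ∈ cellAt C k ↔ ⟨k, z⟩ ∈ C := by
  simp only [cellAt, Finset.mem_image, Finset.mem_filter]
  constructor
  · rintro ⟨⟨l, w⟩, ⟨h, rfl⟩, rfl⟩
    exact h
  · intro h
    exact ⟨_, ⟨h, rfl⟩, rfl⟩

lemma prod_prod_cellAt {M : Type*} [CommMonoid M] {K : ℕ} (C : Finset (Σ _ : Fin K, β))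
    (g : β → M) : ∏ k, ∏ z ∈ cellAt C k, g z = ∏ z ∈ C, g z.2 := by
  rw [Finset.prod_sigma']
  refine Finset.prod_congr ?_ fun _ _ => rfl
  ext ⟨k, z⟩
  simp [mem_cellAt]

/-- One attribution per time step is the same datum as one attribution of the disjoint union. This
merges the `K` likelihoods into one sum over the batch. -/
lemma prod_attributionSum {K : ℕ} (f : Fin K → ι → Finset β → R) (Z : Fin K → Finset β) :
    ∏ k, attributionSum (f k) (Z k)
      = attributionSum (fun i C => ∏ k, f k i (cellAt C k)) (batch Z) := by
  simp only [attributionSum]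
  rw [Finset.prod_univ_sum, Fintype.piFinset_univ]
  let e : (∀ k, Z k → ι) ≃ (batch Z → ι) :=
    { toFun := fun b z => b z.1.1 ⟨z.1.2, (Finset.mem_sigma.1 z.2).2⟩
      invFun := fun a k z => a ⟨⟨k, z⟩, Finset.mem_sigma.2 ⟨Finset.mem_univ _, z.2⟩⟩
      left_inv := fun b => rfl
      right_inv := fun a => rfl }
  refine Fintype.sum_equiv e _ _ fun b => ?_
  rw [Finset.prod_comm]
  refine Finset.prod_congr rfl fun i _ => Finset.prod_congr rfl fun k _ => ?_
  congr 1
  ext z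
  simp [mem_cellAt, mem_fiber, batch]
  rfl

end attribution

/-! ### Attributions as partitions with partial injections of cells -/

section partition

variable {β T R : Type*} [DecidableEq β]

/-- No two members of the family are sent to the same element of `T`. -/
def IsPartialInj {ι T : Type*} (α : ι → Option T) : Prop :=
  ∀ i l, α i ≠ none → i ≠ l → α i ≠ α l

lemma IsPartialInj.eq {ι T : Type*} {α : ι → Option T} (h : IsPartialInj α) {i l : ι} {t : T}
    (hi : α i = some t) (hl : α l = some t) : i = l := by
  by_contra hne
  exact h i l (by simp [hi]) hne (hi.trans hl.symm)

/-- The family with member `none` given by a product over points, and the members of `G`. -/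
def withClutter [CommSemiring R] (cl : β → R) (G : T → Finset β → R) : Option T → Finset β → R
  | none, C => ∏ z ∈ C, cl z
  | some t, C => G t C

/-- The contribution of a cell: `G t C` if it is attributed to `t`, and otherwise the clutter
intensity if it has one element, and `0` if not. -/
def cellFactor [CommSemiring R] (cl : β → R) (G : T → Finset β → R) : Option T → Finset β → R
  | none, C => if C.card = 1 then ∏ z ∈ C, cl z else 0
  | some t, C => G t C

/-- Two points are equivalent if they are equal or are attributed to the same element of `T`. -/
def attributionSetoid {s : Finset β} (b : s → Option T) : Setoid β where
  r z w := z = w ∨ ∃ (hz : z ∈ s) (hw : w ∈ s), b ⟨z, hz⟩ = b ⟨w, hw⟩ ∧ b ⟨z, hz⟩ ≠ none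
  iseqv :=
    { refl := fun _ => Or.inl rfl
      symm := by
        rintro z w (rfl | ⟨hz, hw, h, h'⟩)
        · exact Or.inl rfl
        · exact Or.inr ⟨hw, hz, h.symm, h ▸ h'⟩
      trans := by
        rintro z w v (rfl | ⟨hz, hw, h, h'⟩) (rfl | ⟨hz2, hw2, h2, h2'⟩)
        · exact Or.inl rfl
        · exact Or.inr ⟨hz2, hw2, h2, h2'⟩
        · exact Or.inr ⟨hz, hw, h, h'⟩
        · exact Or.inr ⟨hz, hw2, h.trans h2, h'⟩ }

open Classical in
/-- The partition of `s` into the sets of points with a common source and the single points without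
a source. -/
def attributionPartition {s : Finset β} (b : s → Option T) : Finpartition s :=
  Finpartition.ofSetSetoid (attributionSetoid b) s

/-- A partition is determined by the relation of lying in the same part, so the attributions
inducing `P` are described by a condition on pairs of points. -/
lemma attributionPartition_eq_iff {s : Finset β} {b : s → Option T} {P : Finpartition s} :
    attributionPartition b = P ↔
      ∀ z w : s, P.part z = P.part w ↔ z = w ∨ (b z = b w ∧ b z ≠ none) := by
  classical
  have key : ∀ z w : s, (attributionPartition b).part z = (attributionPartition b).part w ↔
      z = w ∨ (b z = b w ∧ b z ≠ none) := by
    intro z w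
    rw [← Finpartition.mem_part_iff_part_eq_part _ z.2 w.2, attributionPartition,
      Finpartition.mem_part_ofSetSetoid_iff_rel]
    constructor
    · rintro ⟨-, -, h | ⟨hz, hw, h, h'⟩⟩
      · exact Or.inl (Subtype.ext h.symm)
      · exact Or.inr ⟨h.symm, h ▸ h'⟩
    · rintro (rfl | ⟨h, h'⟩)
      · exact ⟨z.2, z.2, Or.inl rfl⟩
      · exact ⟨w.2, z.2, Or.inr ⟨w.2, z.2, h.symm, h ▸ h'⟩⟩
  constructor
  · rintro rfl
    exact key
  · intro h
    have hpart : ∀ z ∈ s, (attributionPartition b).part z = P.part z := by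
      intro z hz
      ext w
      have aux : ∀ Q : Finpartition s, w ∈ Q.part z ↔ ∃ hw : w ∈ s,
          Q.part ((⟨w, hw⟩ : s) : β) = Q.part ((⟨z, hz⟩ : s) : β) := fun Q =>
        ⟨fun hw => ⟨Q.part_subset z hw,
            (Q.mem_part_iff_part_eq_part (Q.part_subset z hw) hz).1 hw⟩,
          fun ⟨hw, h⟩ => (Q.mem_part_iff_part_eq_part hw hz).2 h⟩
      rw [aux, aux]
      exact exists_congr fun hw => (key ⟨w, hw⟩ ⟨z, hz⟩).trans (h ⟨w, hw⟩ ⟨z, hz⟩).symm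
    ext C
    have aux : ∀ Q : Finpartition s, C ∈ Q.parts ↔ ∃ z ∈ s, Q.part z = C := by
      intro Q
      constructor
      · intro hC
        obtain ⟨z, hz⟩ := Q.nonempty_of_mem_parts hC
        exact ⟨z, Q.subset hC hz, Q.part_eq_of_mem hC hz⟩
      · rintro ⟨z, hz, rfl⟩
        exact Q.part_mem.2 hz
    rw [aux, aux]
    exact exists_congr fun z => and_congr_right fun hz => by rw [hpart z hz]

/-- The attribution of points induced by an attribution of the cells of a partition. -/
def pointAttribution {s : Finset β} (P : Finpartition s) (α : P.parts → Option T) (z : s) :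
    Option T :=
  α ⟨P.part z, P.part_mem.2 z.2⟩

lemma pointAttribution_of_mem {s : Finset β} {P : Finpartition s} (α : P.parts → Option T)
    (C : P.parts) {z : β} (hz : z ∈ (C : Finset β)) (hs : z ∈ s) :
    pointAttribution P α ⟨z, hs⟩ = α C := by
  unfold pointAttribution
  congr 1
  exact Subtype.ext (P.part_eq_of_mem C.2 hz)

/-- Injectivity prevents two assigned cells from merging; the cardinality condition prevents an
unassigned cell from splitting into points. -/
lemma attributionPartition_pointAttribution {s : Finset β} {P : Finpartition s}
    {α : P.parts → Option T} (hα : IsPartialInj α)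
    (hcard : ∀ C, α C = none → (C : Finset β).card = 1) :
    attributionPartition (pointAttribution P α) = P := by
  rw [attributionPartition_eq_iff]
  intro z w
  constructor
  · intro h
    have hC : (⟨P.part z, P.part_mem.2 z.2⟩ : P.parts) = ⟨P.part w, P.part_mem.2 w.2⟩ :=
      Subtype.ext h
    by_cases hn : pointAttribution P α z = none
    · left
      obtain ⟨v, hv⟩ := Finset.card_eq_one.1 (hcard _ hn)
      dsimp only at hv
      have h1 : (z : β) ∈ P.part z := P.mem_part z.2
      have h2 : (w : β) ∈ P.part w := P.mem_part w.2
      rw [← h] at h2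
      rw [hv, Finset.mem_singleton] at h1 h2
      exact Subtype.ext (h1.trans h2.symm)
    · exact Or.inr ⟨congrArg α hC, hn⟩
  · rintro (rfl | ⟨h, h'⟩)
    · rfl
    · by_contra hne
      exact hα _ _ h' (fun h'' => hne (congrArg Subtype.val h'')) h

variable [DecidableEq T] [Fintype T] [CommSemiring R]

/-- The fiber over a source is the only cell assigned to it, or empty if there is none; the clutter
fiber is the union of the unassigned cells. -/
lemma prod_attribution_eq_prod_cellFactor (cl : β → R) (G : T → Finset β → R) {s : Finset β}
    {P : Finpartition s} {α : P.parts → Option T} (hα : IsPartialInj α)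
    (hcard : ∀ C, α C = none → (C : Finset β).card = 1) :
    ∏ i, withClutter cl G i (fiber (pointAttribution P α) i) =
      (∏ C, cellFactor cl G (α C) C) *
        ∏ t, if ∀ C, α C ≠ some t then G t ∅ else 1 := by
  have hmem : ∀ (i : Option T) (z : β), z ∈ fiber (pointAttribution P α) i ↔
      ∃ C : P.parts, z ∈ (C : Finset β) ∧ α C = i := by
    intro i z
    rw [mem_fiber]
    constructor
    · rintro ⟨h, h'⟩
      exact ⟨⟨P.part z, P.part_mem.2 h⟩, P.mem_part h, h'⟩
    · rintro ⟨C, hz, rfl⟩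
      exact ⟨P.subset C.2 hz, pointAttribution_of_mem α C hz _⟩
  have hfac : ∀ C : P.parts, cellFactor cl G (α C) C =
      (if α C = none then ∏ z ∈ (C : Finset β), cl z else 1) *
        ∏ t, if α C = some t then G t C else 1 := by
    intro C
    rcases h : α C with _ | t
    · simp [cellFactor, hcard C h]
    · simp [cellFactor]
  rw [Fintype.prod_option, Finset.prod_congr rfl fun C _ => hfac C, Finset.prod_mul_distrib,
    Finset.prod_comm, mul_assoc, ← Finset.prod_mul_distrib]
  congr 1
  · simp only [withClutter]
    rw [prod_fiber]
    refine (Fintype.prod_equiv P.equivSigmaParts _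
      (fun x => if α x.1 = none then cl x.2 else 1) fun z => rfl).trans ?_
    rw [Fintype.prod_sigma]
    refine Finset.prod_congr rfl fun C _ => ?_
    split_ifs
    · exact Finset.prod_coe_sort (C : Finset β) cl
    · simp
  · refine Finset.prod_congr rfl fun t _ => ?_
    simp only [withClutter]
    by_cases h : ∀ C, α C ≠ some t
    · have : fiber (pointAttribution P α) (some t) = ∅ := by
        ext z
        simp only [hmem, Finset.notMem_empty, iff_false, not_exists, not_and]
        exact fun C _ => h C
      simp [h, this]
    · rw [if_neg h, mul_one]
      push Not at h
      obtain ⟨C, hC⟩ := h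
      have : fiber (pointAttribution P α) (some t) = C := by
        ext z
        rw [hmem]
        constructor
        · rintro ⟨D, hz, hD⟩
          rwa [hα.eq hC hD]
        · exact fun hz => ⟨C, hz, hC⟩
      rw [this, Fintype.prod_eq_single C, if_pos hC]
      intro D hD
      rw [if_neg]
      exact fun h => hD (hα.eq h hC)

open Classical in
/-- A sum over attributions of points to sources or clutter is a sum over partitions, and partial
injections of the cells to the sources. -/
theorem attributionSum_withClutter (cl : β → R) (G : T → Finset β → R) (s : Finset β) :
    attributionSum (withClutter cl G) s =
      ∑ P : Finpartition s, ∑ α : P.parts → Option T with IsPartialInj α,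
        (∏ C, cellFactor cl G (α C) C) * ∏ t, if ∀ C, α C ≠ some t then G t ∅ else 1 := by
  unfold attributionSum
  rw [← Finset.sum_fiberwise (s := (Finset.univ : Finset (s → Option T)))
    (g := attributionPartition)]
  refine Finset.sum_congr rfl fun P _ => ?_
  have hsub : (Finset.univ.filter fun α : P.parts → Option T =>
      IsPartialInj α ∧ ∀ C, α C = none → (C : Finset β).card = 1) ⊆
      Finset.univ.filter fun α : P.parts → Option T => IsPartialInj α :=
    Finset.monotone_filter_right _ fun α _ h => h.1
  -- An unassigned cell with more than one point has factor `0`, so only partial injections that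
  -- come from attributions remain.
  rw [← Finset.sum_subset hsub]
  swap
  · intro α hα hα'
    simp only [Finset.mem_filter, Finset.mem_univ, true_and] at hα hα'
    push Not at hα'
    obtain ⟨C, hC, hC'⟩ := hα' hα
    rw [Finset.prod_eq_zero (Finset.mem_univ C), zero_mul]
    simp [hC, cellFactor, hC']
  symm
  -- The inverse reads off the source of a cell at a chosen point of it.
  refine Finset.sum_bij' (fun α _ => pointAttribution P α)
    (fun b _ => fun C => b ⟨(P.nonempty_of_mem_parts C.2).choose,
      P.subset C.2 (P.nonempty_of_mem_parts C.2).choose_spec⟩) ?_ ?_ ?_ ?_ ?_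
  · intro α hα
    simp only [Finset.mem_filter, Finset.mem_univ, true_and] at hα ⊢
    exact attributionPartition_pointAttribution hα.1 hα.2
  · intro b hb
    simp only [Finset.mem_filter, Finset.mem_univ, true_and] at hb ⊢
    rw [attributionPartition_eq_iff] at hb
    constructor
    · intro C D hC hne h
      have := (hb _ _).2 (Or.inr ⟨h, hC⟩)
      rw [P.part_eq_of_mem C.2 (P.nonempty_of_mem_parts C.2).choose_spec,
        P.part_eq_of_mem D.2 (P.nonempty_of_mem_parts D.2).choose_spec] at this
      exact hne (Subtype.ext this)
    · intro C hC
      rw [Finset.card_eq_one]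
      refine ⟨(P.nonempty_of_mem_parts C.2).choose, ?_⟩
      refine Finset.eq_singleton_iff_unique_mem.2
        ⟨(P.nonempty_of_mem_parts C.2).choose_spec, fun w hw => ?_⟩
      rcases (hb ⟨_, P.subset C.2 (P.nonempty_of_mem_parts C.2).choose_spec⟩
        ⟨w, P.subset C.2 hw⟩).1 (by
          rw [P.part_eq_of_mem C.2 (P.nonempty_of_mem_parts C.2).choose_spec,
            P.part_eq_of_mem C.2 hw]) with h | h
      · exact (congrArg Subtype.val h).symm
      · exact absurd hC h.2
  · intro α _
    funext C
    exact pointAttribution_of_mem α C (P.nonempty_of_mem_parts C.2).choose_spec _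
  · intro b hb
    simp only [Finset.mem_filter, Finset.mem_univ, true_and] at hb
    rw [attributionPartition_eq_iff] at hb
    funext z
    have hz : P.part z ∈ P.parts := P.part_mem.2 z.2
    have hc := (P.nonempty_of_mem_parts hz).choose_spec
    rcases (hb ⟨_, P.subset hz hc⟩ z).1 (P.part_eq_of_mem hz hc) with h | h
    · exact congrArg b h
    · exact h.1
  · intro α hα
    simp only [Finset.mem_filter, Finset.mem_univ, true_and] at hα
    rw [prod_attribution_eq_prod_cellFactor cl G hα.1 hα.2]

end partition

/-! ### Expansion of the union of a multi-Bernoulli and a Poisson set -/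

section assignment

variable {X ι : Type*} [DecidableEq X] [Fintype ι]

-- The detected subset is the range of the assignment. Summing over all subsets therefore removes
-- the surjectivity condition, and the elements outside the range carry the Poisson factor.
open Classical in
lemma unionDensity_mbDensity (r : ι → ℝ) (f : ι → X → ℝ) (u : X → ℝ) (Θ : Finset X) :
    unionDensity (mbDensity r f) (fun s => ∏ θ ∈ s, u θ) Θ =
      ∑ α : ι → Option Θ with IsPartialInj α,
        (∏ i, bernoulliDensity (r i) (f i) (assigned (α i))) *
          ∏ t : Θ, if ∀ i, α i ≠ some t then u t else 1 := by
  let rng : (ι → Option Θ) → Finset X := fun α =>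
    (Finset.univ.filter fun t : Θ => ∃ i, α i = some t).image Subtype.val
  have mem_rng : ∀ (α : ι → Option Θ) (t : Θ), (t : X) ∈ rng α ↔ ∃ i, α i = some t := by
    intro α t
    simp [rng]
  have rng_sub : ∀ α, rng α ⊆ Θ := by
    intro α x hx
    simp only [rng, Finset.mem_image] at hx
    obtain ⟨t, -, rfl⟩ := hx
    exact t.2
  unfold unionDensity mbDensity
  rw [← Finset.sum_fiberwise_of_maps_to (t := Θ.powerset) (g := rng)
    (fun α _ => Finset.mem_powerset.2 (rng_sub α))]
  refine Finset.sum_congr rfl fun D hD => ?_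
  have hDΘ := Finset.mem_powerset.1 hD
  have hinc : Function.Injective (fun x : D => (⟨x, hDΘ x.2⟩ : Θ)) := fun x y h =>
    Subtype.ext (congrArg (fun z : Θ => (z : X)) h)
  rw [Finset.sum_mul]
  refine Finset.sum_bij (fun α _ => fun i => (α i).map fun x : D => (⟨x, hDΘ x.2⟩ : Θ))
    ?_ ?_ ?_ ?_
  · intro α hα
    have hα' : IsAssignment α := (Finset.mem_filter.1 hα).2
    simp only [Finset.mem_filter, Finset.mem_univ, true_and]
    constructor
    · intro i l hi hil h
      refine hα'.2 i l (fun h' => hi (by simp [h'])) hil ?_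
      exact Option.map_injective hinc h
    · ext x
      constructor
      · intro hx
        obtain ⟨i, hi⟩ := (mem_rng _ ⟨x, rng_sub _ hx⟩).1 hx
        obtain ⟨y, -, hy⟩ := Option.map_eq_some_iff.1 hi
        obtain rfl : (y : X) = x := congrArg (fun z : Θ => (z : X)) hy
        exact y.2
      · intro hx
        obtain ⟨i, hi⟩ := hα'.1 ⟨x, hx⟩
        exact (mem_rng _ ⟨x, hDΘ hx⟩).2 ⟨i, by simp [hi]⟩
  · intro α _ α' _ h
    funext i
    exact Option.map_injective hinc (congrFun h i)
  · intro α hα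
    simp only [Finset.mem_filter, Finset.mem_univ, true_and] at hα
    obtain ⟨hα, hr⟩ := hα
    have hex : ∀ i, ∃ o : Option D, o.map (fun x : D => (⟨x, hDΘ x.2⟩ : Θ)) = α i := by
      intro i
      rcases h : α i with _ | t
      · exact ⟨none, rfl⟩
      · exact ⟨some ⟨t, hr ▸ (mem_rng α t).2 ⟨i, h⟩⟩, rfl⟩
    choose o ho using hex
    refine ⟨o, Finset.mem_filter.2 ⟨Finset.mem_univ _, ?_, ?_⟩, funext ho⟩
    · intro x
      obtain ⟨i, hi⟩ := (mem_rng α ⟨x, hDΘ x.2⟩).1 (by rw [hr]; exact x.2)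
      refine ⟨i, Option.map_injective hinc ?_⟩
      rw [ho, hi]
      rfl
    · intro i l hi hil h
      refine hα i l (fun h' => hi ?_) hil ?_
      · rw [← ho] at h'
        exact Option.map_eq_none_iff.1 h'
      · rw [← ho, ← ho, h]
  · intro α hα
    have hα' : IsAssignment α := (Finset.mem_filter.1 hα).2
    congr 1
    · refine Finset.prod_congr rfl fun i _ => ?_
      congr 1
      dsimp only
      generalize α i = o
      cases o <;> rfl
    · rw [← Finset.prod_filter]
      refine Finset.prod_bij' (fun x hx => ⟨x, (Finset.mem_sdiff.1 hx).1⟩) (fun t _ => t) ?_ ?_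
        (fun _ _ => rfl) (fun _ _ => rfl) (fun _ _ => rfl)
      · intro x hx
        simp only [Finset.mem_filter, Finset.mem_univ, true_and]
        intro i hi
        obtain ⟨y, -, hy⟩ := Option.map_eq_some_iff.1 hi
        obtain rfl : (y : X) = x := congrArg (fun z : Θ => (z : X)) hy
        exact (Finset.mem_sdiff.1 hx).2 y.2
      · intro t ht
        refine Finset.mem_sdiff.2 ⟨t.2, fun hx => ?_⟩
        obtain ⟨i, hi⟩ := hα'.1 ⟨t, hx⟩
        exact (Finset.mem_filter.1 ht).2 i (by simp [hi])

end assignment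

/-! ### Counting partial injections and exponential series -/

section counting

variable {ι T R : Type*} [Fintype ι] [DecidableEq ι] [Fintype T] [DecidableEq T]
  [CommSemiring R]

open Classical in
/-- Partial injections summed according to their domain. -/
lemma sum_isPartialInj (a b : ι → R) (U : R) :
    ∑ α : ι → Option T with IsPartialInj α,
        (∏ i, (α i).elim (a i) fun _ => b i) * ∏ t, (if ∀ i, α i ≠ some t then U else 1) =
      ∑ S : Finset ι, ((∏ i ∈ S, b i) * ∏ i ∈ Finset.univ \ S, a i) *
        ((Fintype.card T).descFactorial S.card * U ^ (Fintype.card T - S.card)) := by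
  rw [← Finset.sum_fiberwise (g := fun α : ι → Option T => Finset.univ.filter fun i => α i ≠ none)]
  refine Finset.sum_congr rfl fun S _ => ?_
  have hcard : Fintype.card (S ↪ T) = (Fintype.card T).descFactorial S.card := by
    rw [Fintype.card_embedding_eq, Fintype.card_coe]
  -- Partial injections with domain `S` are embeddings of `S`, which the falling factorial counts;
  -- each leaves `card T - card S` elements unhit.
  trans ∑ _e : S ↪ T, ((∏ i ∈ S, b i) * ∏ i ∈ Finset.univ \ S, a i) *
    U ^ (Fintype.card T - S.card)
  swap
  · rw [Finset.sum_const, Finset.card_univ, hcard, nsmul_eq_mul]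
    ring
  symm
  refine Finset.sum_bij (fun e _ => fun i => if h : i ∈ S then some (e ⟨i, h⟩) else none)
    ?_ ?_ ?_ ?_
  · intro e _
    simp only [Finset.mem_filter, Finset.mem_univ, true_and]
    constructor
    · intro i l hi hil h
      by_cases hiS : i ∈ S
      · by_cases hlS : l ∈ S
        · simp only [hiS, hlS, dite_true, Option.some.injEq] at h
          exact hil (congrArg Subtype.val (e.injective h))
        · simp [hiS, hlS] at h
      · simp [hiS] at hi
    · ext i
      simp
  · intro e _ e' _ h
    ext ⟨i, hi⟩
    have := congrFun h i
    simpa [hi] using this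
  · intro α hα
    simp only [Finset.mem_filter, Finset.mem_univ, true_and] at hα
    obtain ⟨hα, hS⟩ := hα
    have hsome : ∀ i : S, ∃ t, α i = some t := fun i =>
      Option.ne_none_iff_exists'.1 (Finset.mem_filter.1 ((Finset.ext_iff.1 hS _).2 i.2)).2
    choose e he using hsome
    refine ⟨⟨e, fun i l h => ?_⟩, Finset.mem_univ _, ?_⟩
    · exact Subtype.ext (hα.eq (he i) (by rw [he l, h]))
    · funext i
      by_cases hi : i ∈ S
      · simp only [hi, dite_true]
        exact (he ⟨i, hi⟩).symm
      · simp only [hi, dite_false]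
        by_contra h
        exact hi ((Finset.ext_iff.1 hS _).1 (Finset.mem_filter.2 ⟨Finset.mem_univ _, Ne.symm h⟩))
  · intro e _
    congr 1
    · rw [← Finset.prod_sdiff (Finset.subset_univ S), mul_comm]
      congr 1
      · refine Finset.prod_congr rfl fun i hi => ?_
        simp [(Finset.mem_sdiff.1 hi).2]
      · refine Finset.prod_congr rfl fun i hi => ?_
        simp [hi]
    · rw [← Finset.prod_filter, Finset.prod_const]
      congr 1
      have : (Finset.univ.filter fun t : T =>
          ∀ i, (if h : i ∈ S then some (e ⟨i, h⟩) else none) ≠ some t) =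
          (Finset.univ.map e)ᶜ := by
        ext t
        simp only [Finset.mem_filter, Finset.mem_univ, true_and, Finset.mem_compl,
          Finset.mem_map, not_exists]
        constructor
        · intro h i hi
          exact h i (by simp [hi])
        · intro h i hi
          split_ifs at hi with hS
          exact h ⟨i, hS⟩ (Option.some.inj hi)
      rw [this, Finset.card_compl, Finset.card_map, Finset.card_univ, Fintype.card_coe]

/-- Terms with `n < m` vanish, and for `n = k + m` the falling factorial reduces `1 / n!` to `1 /
k!`. Independence of `m` is what separates the undetected landmarks from the cells in the evidence.
-/
lemma tsum_inv_factorial_mul_descFactorial (U : ℝ≥0∞) (m : ℕ) :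
    ∑' n : ℕ, ((n.factorial : ℝ≥0∞))⁻¹ * (n.descFactorial m * U ^ (n - m)) =
      ∑' n : ℕ, ((n.factorial : ℝ≥0∞))⁻¹ * U ^ n := by
  rw [← Function.Injective.tsum_eq (add_left_injective m)]
  · refine tsum_congr fun k => ?_
    have h1 : ((k + m).factorial : ℝ≥0∞) = k.factorial * (k + m).descFactorial m := by
      have := Nat.factorial_mul_descFactorial (Nat.le_add_left m k)
      rw [Nat.add_sub_cancel] at this
      exact_mod_cast this.symm
    have h2 : ((k + m).descFactorial m : ℝ≥0∞) ≠ 0 := by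
      simp [Nat.descFactorial_eq_zero_iff_lt]
    rw [Nat.add_sub_cancel, h1, ENNReal.mul_inv (Or.inr (ENNReal.natCast_ne_top _)) (Or.inr h2),
      ← mul_assoc, mul_assoc _ _ ((k + m).descFactorial m : ℝ≥0∞),
      ENNReal.inv_mul_cancel h2 (ENNReal.natCast_ne_top _), mul_one]
  · intro n hn
    have : m ≤ n := by
      by_contra h
      refine hn ?_
      simp [Nat.descFactorial_eq_zero_iff_lt.2 (not_le.1 h)]
    exact ⟨n - m, Nat.sub_add_cancel this⟩

lemma tsum_inv_factorial_mul_pow {x : ℝ} (hx : 0 ≤ x) :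
    ∑' n : ℕ, ((n.factorial : ℝ≥0∞))⁻¹ * ENNReal.ofReal x ^ n = ENNReal.ofReal (Real.exp x) := by
  rw [Real.exp_eq_exp_ℝ, NormedSpace.exp_eq_tsum_div,
    ENNReal.ofReal_tsum_of_nonneg (fun n => by positivity) (Real.summable_pow_div_factorial x)]
  refine tsum_congr fun n => ?_
  rw [ENNReal.ofReal_div_of_pos (by positivity), ENNReal.ofReal_pow hx, ENNReal.ofReal_natCast,
    ENNReal.div_eq_inv_mul]

end counting

/-! ### Product integrals and distinctness of points -/

section integration

variable {X : Type*} [MeasurableSpace X] (μ : Measure X) [SigmaFinite μ]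

lemma lintegral_pi_fin_prod {n : ℕ} {f : Fin n → X → ℝ≥0∞} (hf : ∀ i, Measurable (f i)) :
    ∫⁻ x : Fin n → X, ∏ i, f i (x i) ∂(Measure.pi fun _ => μ) = ∏ i, ∫⁻ x, f i x ∂μ := by
  induction n with
  | zero => simp
  | succ n ih =>
    rw [← (measurePreserving_piFinSuccAbove (fun _ => μ) 0).symm.lintegral_comp_emb
      (MeasurableEquiv.measurableEmbedding _)]
    simp only [MeasurableEquiv.piFinSuccAbove_symm_apply, Fin.insertNthEquiv_apply,
      Fin.prod_univ_succ, Fin.insertNth_zero', Fin.cons_zero, Fin.cons_succ]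
    rw [lintegral_prod_mul (f := f 0) (g := fun y : Fin n → X => ∏ i, f i.succ (y i))
      (hf 0).aemeasurable
      (Finset.measurable_prod _ fun i _ => (hf i.succ).comp (measurable_pi_apply i)).aemeasurable,
      ih fun i => hf i.succ]

/-- Slices of a diagonal are single points, hence null. This allows the set integral to treat the
image of a tuple as having `n` elements. -/
lemma ae_injective_pi_fin [MeasurableEq X] [NullSingletonClass μ] (n : ℕ) :
    ∀ᵐ x : Fin n → X ∂(Measure.pi fun _ => μ), Function.Injective x := by
  have key : ∀ i j : Fin n, i ≠ j → ∀ᵐ x : Fin n → X ∂(Measure.pi fun _ => μ), x i ≠ x j := by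
    intro i j hij
    obtain _ | n := n
    · exact i.elim0
    obtain ⟨k, rfl⟩ := Fin.exists_succAbove_eq (Ne.symm hij)
    have hms : MeasurableSet {p : X × (Fin n → X) | p.1 = p.2 k} :=
      measurableSet_eq_fun measurable_fst ((measurable_pi_apply k).comp measurable_snd)
    have hnull : (μ.prod (Measure.pi fun _ : Fin n => μ)) {p | p.1 = p.2 k} = 0 := by
      rw [Measure.prod_apply_symm hms]
      simp only [Set.preimage_ofPred_eq, Set.ofPred_eq_eq_singleton, measure_singleton,
        lintegral_zero]
    have hmp := measurePreserving_piFinSuccAbove (fun _ : Fin (n + 1) => μ) i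
    have := hmp.quasiMeasurePreserving.ae (p := fun p => p.1 ≠ p.2 k) (by
      rw [ae_iff]
      simpa using hnull)
    filter_upwards [this] with x hx
    exact hx
  have : ∀ᵐ x : Fin n → X ∂(Measure.pi fun _ => μ), ∀ i j : Fin n, i ≠ j → x i ≠ x j := by
    rw [ae_all_iff]
    intro i
    rw [ae_all_iff]
    intro j
    by_cases h : i = j
    · simp [h]
    · filter_upwards [key i j h] with x hx _ using hx
  filter_upwards [this] with x hx i j h
  by_contra hne
  exact hx i j hne h

end integration

/-! ### Integrating and summing attributions in `ℝ≥0∞` -/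

section attributionENNReal

variable {β T : Type*}

lemma withClutter_nonneg {cl : β → ℝ} {G : T → Finset β → ℝ} (hcl : ∀ z, 0 ≤ cl z)
    (hG : ∀ t C, 0 ≤ G t C) (i : Option T) (C : Finset β) : 0 ≤ withClutter cl G i C := by
  cases i
  · exact Finset.prod_nonneg fun z _ => hcl z
  · exact hG _ _

lemma ofReal_withClutter {cl : β → ℝ} {G : T → Finset β → ℝ} (hcl : ∀ z, 0 ≤ cl z)
    (i : Option T) (C : Finset β) : ENNReal.ofReal (withClutter cl G i C) =
      withClutter (fun z => ENNReal.ofReal (cl z)) (fun t C => ENNReal.ofReal (G t C)) i C := by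
  cases i
  · exact ENNReal.ofReal_prod_of_nonneg fun z _ => hcl z
  · rfl

variable [DecidableEq β] [DecidableEq T] [Fintype T]

lemma ofReal_attributionSum_withClutter {cl : β → ℝ} {G : T → Finset β → ℝ}
    (hcl : ∀ z, 0 ≤ cl z) (hG : ∀ t C, 0 ≤ G t C) (s : Finset β) :
    ENNReal.ofReal (attributionSum (withClutter cl G) s) =
      attributionSum (withClutter (fun z => ENNReal.ofReal (cl z))
        (fun t C => ENNReal.ofReal (G t C))) s := by
  unfold attributionSum
  rw [ENNReal.ofReal_sum_of_nonneg fun a _ => Finset.prod_nonneg fun i _ =>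
    withClutter_nonneg hcl hG _ _]
  refine Finset.sum_congr rfl fun a _ => ?_
  rw [ENNReal.ofReal_prod_of_nonneg fun i _ => withClutter_nonneg hcl hG _ _]
  exact Finset.prod_congr rfl fun i _ => ofReal_withClutter hcl _ _

/-- For a fixed attribution the integrand is a product of functions of separate coordinates, so
Tonelli's theorem applies termwise. -/
lemma lintegral_attributionSum_withClutter {X : Type*} [MeasurableSpace X] (μ : Measure X)
    [SigmaFinite μ] (cl : β → ℝ≥0∞) {g : X → Finset β → ℝ≥0∞}
    (hg : ∀ C, Measurable fun θ => g θ C) (s : Finset β) (n : ℕ) :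
    ∫⁻ θ : Fin n → X, attributionSum (withClutter cl fun i C => g (θ i) C) s
        ∂(Measure.pi fun _ => μ) =
      attributionSum (withClutter cl fun (_ : Fin n) C => ∫⁻ x, g x C ∂μ) s := by
  unfold attributionSum
  have hm : ∀ a : s → Option (Fin n),
      Measurable fun θ : Fin n → X => ∏ i, g (θ i) (fiber a (some i)) := fun a =>
    Finset.measurable_prod _ fun i _ => (hg _).comp (measurable_pi_apply i)
  simp only [Fintype.prod_option, withClutter]
  rw [lintegral_finsetSum _ fun a _ => (hm a).const_mul _]
  refine Finset.sum_congr rfl fun a _ => ?_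
  rw [lintegral_const_mul _ (hm a), lintegral_pi_fin_prod μ fun i => hg _]

/-- The exponential generating function of the attributions of the points of `s` to clutter and `n`
exchangeable sources. -/
lemma tsum_attributionSum_withClutter (cl : β → ℝ≥0∞) (G : Finset β → ℝ≥0∞) (s : Finset β) :
    ∑' n : ℕ, ((n.factorial : ℝ≥0∞))⁻¹ *
        attributionSum (withClutter cl fun (_ : Fin n) C => G C) s =
      (∑' n : ℕ, ((n.factorial : ℝ≥0∞))⁻¹ * G ∅ ^ n) *
        ∑ P : Finpartition s, ∏ C ∈ P.parts, (G C + if C.card = 1 then ∏ z ∈ C, cl z else 0) := by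
  classical
  have hfac : ∀ (n : ℕ) (o : Option (Fin n)) (C : Finset β),
      cellFactor cl (fun _ C => G C) o C =
        o.elim (if C.card = 1 then ∏ z ∈ C, cl z else 0) fun _ => G C := by
    intro n o C
    cases o <;> rfl
  have hsum : ∀ n : ℕ, attributionSum (withClutter cl fun (_ : Fin n) C => G C) s =
      ∑ P : Finpartition s, ∑ S : Finset P.parts, ((∏ C ∈ S, G C) * ∏ C ∈ Finset.univ \ S,
        if (C : Finset β).card = 1 then ∏ z ∈ (C : Finset β), cl z else 0) *
          (n.descFactorial S.card * G ∅ ^ (n - S.card)) := by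
    intro n
    rw [attributionSum_withClutter]
    refine Finset.sum_congr rfl fun P _ => ?_
    simp only [hfac]
    have h := sum_isPartialInj (T := Fin n)
      (fun C : P.parts => if (C : Finset β).card = 1 then ∏ z ∈ (C : Finset β), cl z else 0)
      (fun C => G C) (G ∅)
    rw [Fintype.card_fin] at h
    exact h
  simp only [hsum, Finset.mul_sum]
  rw [Summable.tsum_finsetSum fun _ _ => ENNReal.summable]
  refine Finset.sum_congr rfl fun P _ => ?_
  -- Expanding the product over cells chooses the set `S` of cells that have a source; the others
  -- are clutter.
  rw [Summable.tsum_finsetSum fun _ _ => ENNReal.summable, ← Finset.prod_coe_sort,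
    Finset.prod_add, Finset.powerset_univ, Finset.mul_sum]
  refine Finset.sum_congr rfl fun S _ => ?_
  rw [← tsum_inv_factorial_mul_descFactorial (G ∅) S.card, ← ENNReal.tsum_mul_right]
  refine tsum_congr fun n => ?_
  ring

end attributionENNReal

/-! ### The joint density and the evidence as attribution sums -/

section model

variable {K : ℕ} {X Y : Type*} [MeasurableSpace X] [MeasurableSpace Y] {ν : Measure Y}
  (μ : Measure X) (M : MeasurementModel K X Y ν) (lam0 : ℝ) (f0 : X → ℝ)

lemma qD_nonneg (k : Fin K) (θ : X) : 0 ≤ qD M k θ := by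
  have := M.pD_le_one k θ
  have := mul_nonneg (M.pD_nonneg k θ) (Real.exp_nonneg (-M.γ k θ))
  unfold qD
  linarith

lemma qD_le_one (k : Fin K) (θ : X) : qD M k θ ≤ 1 := by
  have h1 : Real.exp (-M.γ k θ) ≤ 1 := Real.exp_le_one_iff.2 (neg_nonpos.2 (M.γ_nonneg k θ))
  have := mul_le_of_le_one_right (M.pD_nonneg k θ) h1
  unfold qD
  linarith

lemma measurable_qD (k : Fin K) : Measurable (qD M k) := by
  have := M.pD_measurable k
  have := M.γ_measurable k
  unfold qD
  fun_prop

/-- The factor of the joint density that does not depend on the map and the measurements. -/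
def voidFactor : ℝ := Real.exp (-lam0) * Real.exp (-M.lamC) ^ K

lemma voidFactor_pos : 0 < voidFactor M lam0 := by
  unfold voidFactor
  positivity

variable [DecidableEq Y]

/-- Joint density of a landmark and the measurements in the cell `C`. -/
def cellJoint (θ : X) (C : Finset (Σ _ : Fin K, Y)) : ℝ :=
  f0 θ * ∏ k, cellStepLikelihood M C k θ

lemma cellStepLikelihood_nonneg (C : Finset (Σ _ : Fin K, Y)) (k : Fin K) (θ : X) :
    0 ≤ cellStepLikelihood M C k θ := by
  unfold cellStepLikelihood
  split_ifs
  · exact qD_nonneg M k θ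
  · exact mul_nonneg (mul_nonneg (M.pD_nonneg k θ) (Real.exp_nonneg _))
      (Finset.prod_nonneg fun z _ => mul_nonneg (M.γ_nonneg k θ) ((M.φ_density θ).nonneg z))

lemma measurable_cellStepLikelihood (C : Finset (Σ _ : Fin K, Y)) (k : Fin K) :
    Measurable (cellStepLikelihood M C k) := by
  unfold cellStepLikelihood
  split_ifs
  · exact measurable_qD M k
  · have h1 := M.pD_measurable k
    have h2 := M.γ_measurable k
    have h3 : ∀ z, Measurable fun θ => M.φ z θ := fun z =>
      M.φ_measurable.comp measurable_prodMk_left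
    fun_prop

variable {f0} in
lemma cellJoint_nonneg (hf0 : ∀ θ, 0 ≤ f0 θ) (θ : X) (C : Finset (Σ _ : Fin K, Y)) :
    0 ≤ cellJoint M f0 θ C :=
  mul_nonneg (hf0 θ) (Finset.prod_nonneg fun k _ => cellStepLikelihood_nonneg M C k θ)

variable {f0} in
lemma measurable_cellJoint (hf0 : Measurable f0) (C : Finset (Σ _ : Fin K, Y)) :
    Measurable fun θ => cellJoint M f0 θ C :=
  hf0.mul (Finset.measurable_prod _ fun k _ => measurable_cellStepLikelihood M C k)

lemma cellStepLikelihood_empty (k : Fin K) : cellStepLikelihood M ∅ k = qD M k := by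
  funext θ
  simp [cellStepLikelihood, cellAt]

lemma undetectedMass_eq_cellMass : undetectedMass μ M f0 = cellMass μ M f0 ∅ := by
  simp [undetectedMass, cellMass, cellStepLikelihood_empty]

lemma undetectedRate_eq_cellL : undetectedRate μ M lam0 f0 = cellL μ M lam0 f0 ∅ := by
  simp [undetectedRate, cellL, undetectedMass_eq_cellMass]

lemma undetectedSpatial_eq_cellSpatial : undetectedSpatial μ M f0 = cellSpatial μ M f0 ∅ := by
  funext θ
  simp [undetectedSpatial, cellSpatial, undetectedMass_eq_cellMass, cellStepLikelihood_empty]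

/-- Only the empty set can arise both from a missed detection and from a detection without
measurements, whence the case distinction in `l_k`. -/
lemma landmarkDensity_cellAt (C : Finset (Σ _ : Fin K, Y)) (k : Fin K) (θ : X) :
    landmarkDensity M k θ (cellAt C k) = cellStepLikelihood M C k θ := by
  unfold landmarkDensity cellStepLikelihood pppDensity
  split_ifs with h
  · simp [h, qD]
  · ring

variable [DecidableEq X]

/-- The prior factor `λ₀ f₀(θ)` is absorbed into the source `θ`, which contributes even when nothing
is attributed to it; the remaining exponentials form `voidFactor`. -/
lemma jointDensity_eq_attributionSum (Z : Fin K → Finset Y) (Θ : Finset X) :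
    jointDensity M lam0 f0 Z Θ = voidFactor M lam0 *
      attributionSum (withClutter (fun z : Σ _ : Fin K, Y => M.lamC * M.c z.2)
        fun (θ : Θ) C => lam0 * cellJoint M f0 θ C) (batch Z) := by
  let F : Fin K → Option Θ → Finset Y → ℝ := fun k o =>
    o.elim (pppDensity M.lamC M.c) fun θ => landmarkDensity M k θ
  have hstep : ∀ k, stepLikelihood M k Θ (Z k) = attributionSum (F k) (Z k) := fun k =>
    unionDensity_unionFamilyDensity (F k) (Z k)
  unfold jointDensity
  simp only [hstep]
  rw [prod_attributionSum, attributionSum, attributionSum, Finset.mul_sum, Finset.mul_sum]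
  refine Finset.sum_congr rfl fun a _ => ?_
  have hclut : ∏ k, pppDensity M.lamC M.c (cellAt (fiber a none) k) =
      Real.exp (-M.lamC) ^ K * ∏ z ∈ fiber a none, M.lamC * M.c z.2 := by
    simp only [pppDensity]
    rw [Finset.prod_mul_distrib, Finset.prod_const, Finset.card_univ, Fintype.card_fin,
      prod_prod_cellAt _ fun z => M.lamC * M.c z]
  simp only [Fintype.prod_option, withClutter, F, Option.elim, landmarkDensity_cellAt, hclut,
    cellJoint]
  simp only [← mul_assoc lam0]
  rw [Finset.prod_mul_distrib (s := (Finset.univ : Finset Θ)),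
    Finset.prod_coe_sort Θ fun θ => lam0 * f0 θ, pppDensity, voidFactor]
  ring

variable [MeasurableEq X] [SigmaFinite μ] [NullSingletonClass μ]

variable {lam0 f0} in
lemma evidence_eq (hlam0 : 0 ≤ lam0) (hf0 : IsProbDensity f0 μ) (Z : Fin K → Finset Y) :
    evidence μ M lam0 f0 Z = ENNReal.ofReal (voidFactor M lam0) *
      ((∑' n : ℕ, ((n.factorial : ℝ≥0∞))⁻¹ *
          (∫⁻ θ, ENNReal.ofReal (lam0 * cellJoint M f0 θ ∅) ∂μ) ^ n) *
        ∑ P : Finpartition (batch Z), ∏ C ∈ P.parts,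
          ((∫⁻ θ, ENNReal.ofReal (lam0 * cellJoint M f0 θ C) ∂μ) +
            if C.card = 1 then ∏ z ∈ C, ENNReal.ofReal (M.lamC * M.c z.2) else 0)) := by
  unfold evidence setLIntegral
  rw [← tsum_attributionSum_withClutter (fun z : Σ _ : Fin K, Y => ENNReal.ofReal (M.lamC * M.c z.2))
    (fun C => ∫⁻ θ, ENNReal.ofReal (lam0 * cellJoint M f0 θ C) ∂μ), ← ENNReal.tsum_mul_left]
  refine tsum_congr fun n => ?_
  rw [mul_left_comm]
  congr 1
  have hg : ∀ C : Finset (Σ _ : Fin K, Y),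
      Measurable fun θ => ENNReal.ofReal (lam0 * cellJoint M f0 θ C) := fun C =>
    ((measurable_cellJoint M hf0.measurable C).const_mul _).ennreal_ofReal
  rw [← lintegral_attributionSum_withClutter μ _ hg, ← lintegral_const_mul' _ _
    ENNReal.ofReal_ne_top]
  refine lintegral_congr_ae ?_
  filter_upwards [ae_injective_pi_fin μ n] with θ hθ
  have hcl : ∀ z : Σ _ : Fin K, Y, 0 ≤ M.lamC * M.c z.2 := fun z =>
    mul_nonneg M.lamC_nonneg (M.c_density.nonneg _)
  have hG : ∀ x C, 0 ≤ lam0 * cellJoint M f0 x C := fun x C =>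
    mul_nonneg hlam0 (cellJoint_nonneg M hf0.nonneg x C)
  rw [jointDensity_eq_attributionSum, ENNReal.ofReal_mul (voidFactor_pos M lam0).le,
    ofReal_attributionSum_withClutter hcl fun _ _ => hG _ _]
  congr 1
  -- For an injective tuple, sources indexed by the landmark set can be relabelled by `Fin n`.
  let e : Fin n ≃ (Finset.univ.image θ : Finset X) :=
    Equiv.ofBijective (fun i => ⟨θ i, Finset.mem_image_of_mem θ (Finset.mem_univ i)⟩)
      ⟨fun i j h => hθ (congrArg Subtype.val h), fun ⟨x, hx⟩ => by
        obtain ⟨i, -, rfl⟩ := Finset.mem_image.1 hx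
        exact ⟨i, rfl⟩⟩
  rw [← attributionSum_comp_equiv e.optionCongr]
  congr 1
  funext i C
  cases i <;> rfl

end model

/-! ### Finiteness, normalization and comparison with the mixture -/

section posterior

variable {K : ℕ} {X Y : Type*} [MeasurableSpace X] [MeasurableSpace Y]
  {μ : Measure X} {ν : Measure Y} (M : MeasurementModel K X Y ν) {lam0 : ℝ} {f0 : X → ℝ}

/-- The clutter intensity of one-element cells, extended by `0`. -/
def isolatedClutter (C : Finset (Σ _ : Fin K, Y)) : ℝ≥0∞ :=
  if C.card = 1 then ∏ z ∈ C, ENNReal.ofReal (M.lamC * M.c z.2) else 0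

lemma clutter_nonneg (z : Σ _ : Fin K, Y) : 0 ≤ M.lamC * M.c z.2 :=
  mul_nonneg M.lamC_nonneg (M.c_density.nonneg _)

lemma cellClutter_nonneg (C : Finset (Σ _ : Fin K, Y)) : 0 ≤ cellClutter M C :=
  Finset.prod_nonneg fun z _ => clutter_nonneg M z

lemma isolatedClutter_eq (C : Finset (Σ _ : Fin K, Y)) :
    isolatedClutter M C = ENNReal.ofReal (if C.card = 1 then cellClutter M C else 0) := by
  unfold isolatedClutter cellClutter
  split_ifs
  · rw [ENNReal.ofReal_prod_of_nonneg fun z _ => clutter_nonneg M z]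
  · simp

variable [DecidableEq Y]

variable (μ lam0 f0) in
/-- The extended nonnegative version of `cellL`, for which divergent integrals are infinite. -/
def cellLE (C : Finset (Σ _ : Fin K, Y)) : ℝ≥0∞ :=
  ∫⁻ θ, ENNReal.ofReal (lam0 * cellJoint M f0 θ C) ∂μ

/-- No integrability is needed: for a divergent integral both sides take the default value `0`. -/
lemma cellMass_eq_toReal (hf0 : IsProbDensity f0 μ) (C : Finset (Σ _ : Fin K, Y)) :
    cellMass μ M f0 C = (∫⁻ θ, ENNReal.ofReal (cellJoint M f0 θ C) ∂μ).toReal :=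
  integral_eq_lintegral_of_nonneg_ae
    (Filter.Eventually.of_forall fun θ => cellJoint_nonneg M hf0.nonneg θ C)
    (measurable_cellJoint M hf0.measurable C).aestronglyMeasurable

lemma cellMass_nonneg (hf0 : IsProbDensity f0 μ) (C : Finset (Σ _ : Fin K, Y)) :
    0 ≤ cellMass μ M f0 C := by
  rw [cellMass_eq_toReal M hf0]
  exact ENNReal.toReal_nonneg

lemma cellLE_eq (hlam0 : 0 ≤ lam0) (C : Finset (Σ _ : Fin K, Y)) : cellLE μ M lam0 f0 C =
    ENNReal.ofReal lam0 * ∫⁻ θ, ENNReal.ofReal (cellJoint M f0 θ C) ∂μ := by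
  rw [← lintegral_const_mul' _ _ ENNReal.ofReal_ne_top]
  exact lintegral_congr fun θ => ENNReal.ofReal_mul hlam0

lemma toReal_cellLE (hlam0 : 0 ≤ lam0) (hf0 : IsProbDensity f0 μ)
    (C : Finset (Σ _ : Fin K, Y)) : (cellLE μ M lam0 f0 C).toReal = cellL μ M lam0 f0 C := by
  rw [cellLE_eq M hlam0, ENNReal.toReal_mul, ENNReal.toReal_ofReal hlam0, cellL,
    cellMass_eq_toReal M hf0]

lemma cellL_nonneg (hlam0 : 0 ≤ lam0) (hf0 : IsProbDensity f0 μ)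
    (C : Finset (Σ _ : Fin K, Y)) : 0 ≤ cellL μ M lam0 f0 C :=
  mul_nonneg hlam0 (cellMass_nonneg M hf0 C)

/-- Since `q_D ≤ 1`, the integrand without `λ₀` is dominated by the integrable `f0`. Larger cells
have no such bound. -/
lemma cellLE_empty_ne_top (hlam0 : 0 ≤ lam0) (hf0 : IsProbDensity f0 μ) :
    cellLE μ M lam0 f0 ∅ ≠ ∞ := by
  rw [cellLE_eq M hlam0]
  refine ENNReal.mul_ne_top ENNReal.ofReal_ne_top (ne_top_of_le_ne_top (b :=
    ∫⁻ θ, ENNReal.ofReal (f0 θ) ∂μ) ?_ (lintegral_mono fun θ => ENNReal.ofReal_le_ofReal ?_))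
  · have hint : Integrable f0 μ := by
      by_contra h
      have := hf0.integral_eq_one
      rw [integral_undef h] at this
      exact zero_ne_one this
    exact Integrable.lintegral_lt_top hint |>.ne
  · unfold cellJoint
    refine mul_le_of_le_one_right (hf0.nonneg θ) (Finset.prod_le_one
      (fun k _ => cellStepLikelihood_nonneg M _ k θ) fun k _ => ?_)
    rw [cellStepLikelihood_empty]
    exact qD_le_one M k θ

lemma cellLikelihood_nonneg (hlam0 : 0 ≤ lam0) (hf0 : IsProbDensity f0 μ)
    (C : Finset (Σ _ : Fin K, Y)) : 0 ≤ cellLikelihood μ M lam0 f0 C := by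
  have h1 := cellL_nonneg M hlam0 hf0 C
  have h2 := cellClutter_nonneg M C
  unfold cellLikelihood
  split_ifs <;> positivity

lemma toReal_cellLE_add_isolatedClutter (hlam0 : 0 ≤ lam0) (hf0 : IsProbDensity f0 μ)
    {C : Finset (Σ _ : Fin K, Y)} (hC : cellLE μ M lam0 f0 C ≠ ∞) :
    (cellLE μ M lam0 f0 C + isolatedClutter M C).toReal = cellLikelihood μ M lam0 f0 C := by
  rw [isolatedClutter_eq, ENNReal.toReal_add hC ENNReal.ofReal_ne_top, toReal_cellLE M hlam0 hf0,
    ENNReal.toReal_ofReal (by split_ifs; exacts [cellClutter_nonneg M C, le_rfl]), cellLikelihood]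
  split_ifs <;> ring

/-- A finite product of extended nonnegative numbers either has only finite factors or has a zero
factor. -/
lemma forall_ne_top_or_exists_eq_zero_of_prod_ne_top {ι : Type*} {s : Finset ι} {f : ι → ℝ≥0∞}
    (h : ∏ i ∈ s, f i ≠ ∞) : (∀ i ∈ s, f i ≠ ∞) ∨ ∃ i ∈ s, f i = 0 := by
  classical
  by_contra! hcon
  obtain ⟨⟨i, hi, htop⟩, hne⟩ := hcon
  refine h ?_
  rw [← Finset.mul_prod_erase s f hi, htop, ENNReal.top_mul]
  exact Finset.prod_ne_zero_iff.2 fun j hj => hne j (Finset.mem_of_mem_erase hj)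

lemma toReal_prod_cellLE_add_isolatedClutter (hlam0 : 0 ≤ lam0) (hf0 : IsProbDensity f0 μ)
    {s : Finset (Finset (Σ _ : Fin K, Y))}
    (hs : ∏ C ∈ s, (cellLE μ M lam0 f0 C + isolatedClutter M C) ≠ ∞) :
    (∏ C ∈ s, (cellLE μ M lam0 f0 C + isolatedClutter M C)).toReal =
      ∏ C ∈ s, cellLikelihood μ M lam0 f0 C := by
  rcases forall_ne_top_or_exists_eq_zero_of_prod_ne_top hs with h | ⟨C, hC, h⟩
  · rw [ENNReal.toReal_prod]
    exact Finset.prod_congr rfl fun C hC => toReal_cellLE_add_isolatedClutter M hlam0 hf0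
      (ENNReal.add_ne_top.1 (h C hC)).1
  · rw [Finset.prod_eq_zero hC h, Finset.prod_eq_zero hC, ENNReal.toReal_zero]
    rw [← toReal_cellLE_add_isolatedClutter M hlam0 hf0, h, ENNReal.toReal_zero]
    rw [(add_eq_zero.1 h).1]
    exact ENNReal.zero_ne_top

variable (μ f0) in
/-- The states at which the joint density with some cell is positive although the mass of this cell
vanishes. -/
def exceptionalSet (Z : Fin K → Finset Y) : Set X :=
  {θ | ∃ C ⊆ batch Z, ∫⁻ x, ENNReal.ofReal (cellJoint M f0 x C) ∂μ = 0 ∧ cellJoint M f0 θ C ≠ 0}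

/-- A nonnegative function with zero integral vanishes almost everywhere, and only finitely many
cells are involved. -/
lemma measure_exceptionalSet (hf0 : IsProbDensity f0 μ) (Z : Fin K → Finset Y) :
    μ (exceptionalSet μ M f0 Z) = 0 := by
  have : exceptionalSet μ M f0 Z ⊆ ⋃ C ∈ (batch Z).powerset,
      {θ | ∫⁻ x, ENNReal.ofReal (cellJoint M f0 x C) ∂μ = 0 ∧ cellJoint M f0 θ C ≠ 0} := by
    rintro θ ⟨C, hC, h⟩
    exact Set.mem_biUnion (Finset.mem_powerset.2 hC) h
  refine measure_mono_null this ((measure_biUnion_null_iff (Finset.countable_toSet _)).2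
    fun C _ => ?_)
  by_cases h : ∫⁻ x, ENNReal.ofReal (cellJoint M f0 x C) ∂μ = 0
  · rw [lintegral_eq_zero_iff (measurable_cellJoint M hf0.measurable C).ennreal_ofReal] at h
    refine measure_mono_null (fun θ hθ => ?_) (ae_iff.1 h)
    intro h0
    exact hθ.2 (le_antisymm (ENNReal.ofReal_eq_zero.1 h0) (cellJoint_nonneg M hf0.nonneg θ C))
  · simp [h]

lemma exceptionalSet_eq_empty (hf0 : IsProbDensity f0 μ) {Z : Fin K → Finset Y}
    (h : ∀ C ⊆ batch Z, cellMass μ M f0 C ≠ 0) : exceptionalSet μ M f0 Z = ∅ := by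
  refine Set.eq_empty_of_forall_notMem ?_
  rintro θ ⟨C, hC, h0, -⟩
  refine h C hC ?_
  rw [cellMass_eq_toReal M hf0, h0, ENNReal.toReal_zero]

lemma cellL_mul_cellSpatial (hlam0 : 0 ≤ lam0) (hf0 : IsProbDensity f0 μ) {Z : Fin K → Finset Y}
    {C : Finset (Σ _ : Fin K, Y)} (hCZ : C ⊆ batch Z) (hC : cellLE μ M lam0 f0 C ≠ ∞) {θ : X}
    (hθ : θ ∉ exceptionalSet μ M f0 Z) :
    cellL μ M lam0 f0 C * cellSpatial μ M f0 C θ = lam0 * cellJoint M f0 θ C := by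
  change lam0 * cellMass μ M f0 C * (cellJoint M f0 θ C / cellMass μ M f0 C) = _
  by_cases hm : cellMass μ M f0 C = 0
  -- A real mass of `0` means zero or divergent. Divergence with `lam0 ≠ 0` contradicts `hC`; a zero
  -- integral forces the joint density to vanish off the exceptional set.
  · rcases eq_or_ne lam0 0 with rfl | hl
    · simp
    · have h0 : ∫⁻ x, ENNReal.ofReal (cellJoint M f0 x C) ∂μ = 0 := by
        rw [cellMass_eq_toReal M hf0, ENNReal.toReal_eq_zero_iff] at hm
        refine hm.resolve_right fun htop => hC ?_
        rw [cellLE_eq M hlam0, htop, ENNReal.mul_top]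
        simpa using lt_of_le_of_ne hlam0 (Ne.symm hl)
      have : cellJoint M f0 θ C = 0 := by
        by_contra h
        exact hθ ⟨C, hCZ, h0, h⟩
      simp [this]
  · field_simp

/-- The unnormalized Bernoulli density of a cell. -/
lemma cellLikelihood_mul_bernoulliDensity [DecidableEq X] (hlam0 : 0 ≤ lam0)
    (hf0 : IsProbDensity f0 μ) {Z : Fin K → Finset Y} {C : Finset (Σ _ : Fin K, Y)}
    (hCZ : C ⊆ batch Z) (hC : cellLE μ M lam0 f0 C ≠ ∞) {Θ : Finset X}
    (hΘ : ∀ θ ∈ Θ, θ ∉ exceptionalSet μ M f0 Z) (o : Option Θ) :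
    cellLikelihood μ M lam0 f0 C *
        bernoulliDensity (cellExistence μ M lam0 f0 C) (cellSpatial μ M f0 C) (assigned o) =
      cellFactor (fun z : Σ _ : Fin K, Y => M.lamC * M.c z.2)
        (fun (θ : Θ) C => lam0 * cellJoint M f0 θ C) o C := by
  have hL := cellL_nonneg M hlam0 hf0 C
  have hc := cellClutter_nonneg M C
  rcases o with _ | θ
  · simp only [assigned, bernoulliDensity, cellFactor, cellLikelihood, cellExistence, if_true]
    split_ifs with h
    · change _ = cellClutter M C
      -- If the denominator of the existence probability vanishes, clutter and `L` are both `0`, so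
      -- the default quotient does no harm.
      rcases (add_nonneg hc hL).eq_or_lt with h0 | hpos
      · rw [← h0, zero_mul]
        linarith
      · field_simp
        ring
    · simp
  · have hE : cellLikelihood μ M lam0 f0 C * cellExistence μ M lam0 f0 C =
        cellL μ M lam0 f0 C := by
      unfold cellLikelihood cellExistence
      split_ifs
      · rcases (add_nonneg hc hL).eq_or_lt with h0 | hpos
        · rw [← h0, zero_mul]
          linarith
        · field_simp
      · ring
    simp only [assigned, bernoulliDensity, cellFactor, Finset.singleton_ne_empty, if_false,
      Finset.card_singleton, if_true, Finset.prod_singleton]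
    rw [← mul_assoc, hE]
    exact cellL_mul_cellSpatial M hlam0 hf0 hCZ hC (hΘ θ θ.2)

lemma isProbDensity_cellSpatial (hf0 : IsProbDensity f0 μ) {C : Finset (Σ _ : Fin K, Y)}
    (hC : cellMass μ M f0 C ≠ 0) : IsProbDensity (cellSpatial μ M f0 C) μ where
  measurable := (measurable_cellJoint M hf0.measurable C).div_const _
  nonneg θ := div_nonneg (cellJoint_nonneg M hf0.nonneg θ C) (cellMass_nonneg M hf0 C)
  integral_eq_one := by
    change ∫ θ, cellJoint M f0 θ C / cellMass μ M f0 C ∂μ = 1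
    rw [integral_div]
    exact div_self hC

variable [DecidableEq X] [MeasurableEq X] [SigmaFinite μ] [NullSingletonClass μ]

lemma evidence_eq_exp_mul_sum (hlam0 : 0 ≤ lam0) (hf0 : IsProbDensity f0 μ)
    (Z : Fin K → Finset Y) :
    evidence μ M lam0 f0 Z = ENNReal.ofReal (voidFactor M lam0) *
      (ENNReal.ofReal (Real.exp (cellL μ M lam0 f0 ∅)) *
        ∑ P : Finpartition (batch Z), ∏ C ∈ P.parts,
          (cellLE μ M lam0 f0 C + isolatedClutter M C)) := by
  rw [evidence_eq μ M hlam0 hf0, ← tsum_inv_factorial_mul_pow (cellL_nonneg M hlam0 hf0 ∅),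
    ← toReal_cellLE M hlam0 hf0, ENNReal.ofReal_toReal (cellLE_empty_ne_top M hlam0 hf0)]
  rfl

lemma sum_prod_cellLE_add_isolatedClutter_ne (hlam0 : 0 ≤ lam0) (hf0 : IsProbDensity f0 μ)
    {Z : Fin K → Finset Y} (hZpos : evidence μ M lam0 f0 Z ≠ 0)
    (hZfin : evidence μ M lam0 f0 Z ≠ ∞) :
    ∑ P : Finpartition (batch Z), ∏ C ∈ P.parts,
        (cellLE μ M lam0 f0 C + isolatedClutter M C) ≠ 0 ∧
      ∑ P : Finpartition (batch Z), ∏ C ∈ P.parts,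
        (cellLE μ M lam0 f0 C + isolatedClutter M C) ≠ ∞ := by
  rw [evidence_eq_exp_mul_sum M hlam0 hf0] at hZpos hZfin
  refine ⟨right_ne_zero_of_mul (right_ne_zero_of_mul hZpos), fun h => hZfin ?_⟩
  rw [h, ENNReal.mul_top (by simpa using Real.exp_pos _),
    ENNReal.mul_top (by simpa using voidFactor_pos M lam0)]

lemma prod_cellLE_add_isolatedClutter_ne_top (hlam0 : 0 ≤ lam0) (hf0 : IsProbDensity f0 μ)
    {Z : Fin K → Finset Y} (hZpos : evidence μ M lam0 f0 Z ≠ 0)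
    (hZfin : evidence μ M lam0 f0 Z ≠ ∞) (P : Finpartition (batch Z)) :
    ∏ C ∈ P.parts, (cellLE μ M lam0 f0 C + isolatedClutter M C) ≠ ∞ :=
  ENNReal.sum_ne_top.1 (sum_prod_cellLE_add_isolatedClutter_ne M hlam0 hf0 hZpos hZfin).2 P
    (Finset.mem_univ P)

lemma toReal_sum_prod_cellLE (hlam0 : 0 ≤ lam0) (hf0 : IsProbDensity f0 μ)
    {Z : Fin K → Finset Y} (hZpos : evidence μ M lam0 f0 Z ≠ 0)
    (hZfin : evidence μ M lam0 f0 Z ≠ ∞) :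
    (∑ P : Finpartition (batch Z), ∏ C ∈ P.parts,
        (cellLE μ M lam0 f0 C + isolatedClutter M C)).toReal =
      ∑ P : Finpartition (batch Z), ∏ C ∈ P.parts, cellLikelihood μ M lam0 f0 C := by
  have hne := prod_cellLE_add_isolatedClutter_ne_top M hlam0 hf0 hZpos hZfin
  rw [ENNReal.toReal_sum fun P _ => hne P]
  exact Finset.sum_congr rfl fun P _ => toReal_prod_cellLE_add_isolatedClutter M hlam0 hf0 (hne P)

lemma sum_prod_cellLikelihood_ne_zero (hlam0 : 0 ≤ lam0) (hf0 : IsProbDensity f0 μ)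
    {Z : Fin K → Finset Y} (hZpos : evidence μ M lam0 f0 Z ≠ 0)
    (hZfin : evidence μ M lam0 f0 Z ≠ ∞) :
    ∑ P : Finpartition (batch Z), ∏ C ∈ P.parts, cellLikelihood μ M lam0 f0 C ≠ 0 := by
  obtain ⟨h0, htop⟩ := sum_prod_cellLE_add_isolatedClutter_ne M hlam0 hf0 hZpos hZfin
  rw [← toReal_sum_prod_cellLE M hlam0 hf0 hZpos hZfin]
  exact ENNReal.toReal_ne_zero.2 ⟨h0, htop⟩

lemma posteriorDensity_eq_pmbmDensity (hlam0 : 0 ≤ lam0) (hf0 : IsProbDensity f0 μ)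
    {Z : Fin K → Finset Y} (hZpos : evidence μ M lam0 f0 Z ≠ 0)
    (hZfin : evidence μ M lam0 f0 Z ≠ ∞) {Θ : Finset X}
    (hΘ : ∀ θ ∈ Θ, θ ∉ exceptionalSet μ M f0 Z) :
    posteriorDensity μ M lam0 f0 Z Θ =
      pmbmDensity (undetectedRate μ M lam0 f0) (undetectedSpatial μ M f0) (weight μ M lam0 f0 Z)
        (fun (P : Finpartition (batch Z)) (C : P.parts) => cellExistence μ M lam0 f0 C)
        (fun (P : Finpartition (batch Z)) (C : P.parts) => cellSpatial μ M f0 C) Θ := by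
  classical
  set S := ∑ P : Finpartition (batch Z), ∏ C ∈ P.parts, cellLikelihood μ M lam0 f0 C with hS
  set ℓ := cellL μ M lam0 f0 ∅ with hℓ
  have hS0 : S ≠ 0 := sum_prod_cellLikelihood_ne_zero M hlam0 hf0 hZpos hZfin
  have hpost : posteriorDensity μ M lam0 f0 Z Θ = Real.exp (-ℓ) / S *
      attributionSum (withClutter (fun z : Σ _ : Fin K, Y => M.lamC * M.c z.2)
        fun (θ : Θ) C => lam0 * cellJoint M f0 θ C) (batch Z) := by
    have hv := (voidFactor_pos M lam0).ne'
    have he := Real.exp_ne_zero ℓ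
    rw [posteriorDensity, jointDensity_eq_attributionSum, evidence_eq_exp_mul_sum M hlam0 hf0,
      ENNReal.toReal_mul, ENNReal.toReal_mul, toReal_sum_prod_cellLE M hlam0 hf0 hZpos hZfin,
      ENNReal.toReal_ofReal (voidFactor_pos M lam0).le, ENNReal.toReal_ofReal (Real.exp_nonneg _),
      Real.exp_neg, ← hS, ← hℓ]
    field_simp
  -- Undetected landmarks are those with the empty cell, so `λ_K^u = L_∅` and the Poisson factors
  -- are those of sources without measurements.
  have hu : ∀ s ⊆ Θ, pppDensity (undetectedRate μ M lam0 f0) (undetectedSpatial μ M f0) s =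
      Real.exp (-ℓ) * ∏ θ ∈ s, lam0 * cellJoint M f0 θ ∅ := by
    intro s hs
    rw [pppDensity, undetectedRate_eq_cellL, undetectedSpatial_eq_cellSpatial]
    congr 1
    exact Finset.prod_congr rfl fun θ hθ => cellL_mul_cellSpatial M hlam0 hf0
      (Finset.empty_subset _) (cellLE_empty_ne_top M hlam0 hf0) (hΘ θ (hs hθ))
  have hpmbm : pmbmDensity (undetectedRate μ M lam0 f0) (undetectedSpatial μ M f0)
        (weight μ M lam0 f0 Z)
        (fun (P : Finpartition (batch Z)) (C : P.parts) => cellExistence μ M lam0 f0 C)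
        (fun (P : Finpartition (batch Z)) (C : P.parts) => cellSpatial μ M f0 C) Θ =
      Real.exp (-ℓ) / S * ∑ P : Finpartition (batch Z),
        (∏ C ∈ P.parts, cellLikelihood μ M lam0 f0 C) *
          unionDensity (mbDensity (fun C : P.parts => cellExistence μ M lam0 f0 C)
            fun C : P.parts => cellSpatial μ M f0 C)
            (fun s => ∏ θ ∈ s, lam0 * cellJoint M f0 θ ∅) Θ := by
    unfold pmbmDensity unionDensity mbmDensity
    simp only [Finset.sum_mul, Finset.mul_sum]
    rw [Finset.sum_comm]
    refine Finset.sum_congr rfl fun P _ => Finset.sum_congr rfl fun D _ => ?_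
    rw [hu _ Finset.sdiff_subset, weight, ← hS]
    ring
  rw [hpost, hpmbm, attributionSum_withClutter]
  congr 1
  refine Finset.sum_congr rfl fun P _ => ?_
  rw [unionDensity_mbDensity, Finset.mul_sum]
  refine Finset.sum_congr (by ext; simp) fun α _ => ?_
  rw [← mul_assoc, ← Finset.prod_coe_sort P.parts fun C => cellLikelihood μ M lam0 f0 C,
    ← Finset.prod_mul_distrib]
  congr 1
  -- Either all cells have finite mass and the factors match one by one, or some cell has likelihood
  -- `0` and both products vanish, whatever the other cells give.
  rcases forall_ne_top_or_exists_eq_zero_of_prod_ne_top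
    (prod_cellLE_add_isolatedClutter_ne_top M hlam0 hf0 hZpos hZfin P) with h | ⟨C, hC, h⟩
  · exact Finset.prod_congr rfl fun C _ => (cellLikelihood_mul_bernoulliDensity M hlam0 hf0
      (P.subset C.2) (ENNReal.add_ne_top.1 (h C C.2)).1 hΘ (α C)).symm
  · have hfin : cellLE μ M lam0 f0 C ≠ ∞ := by
      rw [(add_eq_zero.1 h).1]
      exact ENNReal.zero_ne_top
    have hlik : cellLikelihood μ M lam0 f0 C = 0 := by
      rw [← toReal_cellLE_add_isolatedClutter M hlam0 hf0 hfin, h, ENNReal.toReal_zero]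
    rw [Finset.prod_eq_zero (Finset.mem_univ (⟨C, hC⟩ : P.parts)),
      Finset.prod_eq_zero (Finset.mem_univ (⟨C, hC⟩ : P.parts))]
    · simp [hlik]
    · rw [← cellLikelihood_mul_bernoulliDensity M hlam0 hf0 (P.subset hC) hfin hΘ, hlik, zero_mul]

end posterior

end PMBM

end

/-! ### The theorem -/

theorem theorem1 {X Y : Type*} [MeasurableSpace X] [MeasurableEq X] [DecidableEq X]
    [MeasurableSpace Y] [DecidableEq Y] (μ : Measure X) [SigmaFinite μ] [NullSingletonClass μ]
    (ν : Measure Y) {K : ℕ} (M : PMBM.MeasurementModel K X Y ν)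
    (lam0 : ℝ) (hlam0 : 0 ≤ lam0) (f0 : X → ℝ) (hf0 : PMBM.IsProbDensity f0 μ)
    (Z : Fin K → Finset Y)
    (hZpos : PMBM.evidence μ M lam0 f0 Z ≠ 0) (hZfin : PMBM.evidence μ M lam0 f0 Z ≠ ∞) :
    -- the posterior density is the PMBM density with the stated parameters
    (∃ N : Set X, μ N = 0 ∧
      ((∀ C : Finset (Σ _ : Fin K, Y), C ⊆ PMBM.batch Z → C.Nonempty →
          PMBM.cellMass μ M f0 C ≠ 0) → PMBM.undetectedMass μ M f0 ≠ 0 → N = ∅) ∧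
      ∀ Θ : Finset X, (∀ θ ∈ Θ, θ ∉ N) →
        PMBM.posteriorDensity μ M lam0 f0 Z Θ =
          PMBM.pmbmDensity
            (PMBM.undetectedRate μ M lam0 f0) (PMBM.undetectedSpatial μ M f0)
            (PMBM.weight μ M lam0 f0 Z)
            (fun (P : Finpartition (PMBM.batch Z)) (C : P.parts) =>
              PMBM.cellExistence μ M lam0 f0 C)
            (fun (P : Finpartition (PMBM.batch Z)) (C : P.parts) =>
              PMBM.cellSpatial μ M f0 C) Θ) ∧
    -- the weights form a probability vector
    (∀ P, 0 ≤ PMBM.weight μ M lam0 f0 Z P) ∧ ∑ P, PMBM.weight μ M lam0 f0 Z P = 1 ∧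
    -- the Bernoulli and Poisson parameters are proper
    (∀ C : Finset (Σ _ : Fin K, Y), C ⊆ PMBM.batch Z → C.Nonempty →
      0 ≤ PMBM.cellExistence μ M lam0 f0 C ∧ PMBM.cellExistence μ M lam0 f0 C ≤ 1) ∧
    (∀ P : Finpartition (PMBM.batch Z), PMBM.weight μ M lam0 f0 Z P ≠ 0 → ∀ C ∈ P.parts,
      PMBM.cellExistence μ M lam0 f0 C ≠ 0 →
        PMBM.IsProbDensity (PMBM.cellSpatial μ M f0 C) μ) ∧
    0 ≤ PMBM.undetectedRate μ M lam0 f0 ∧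
    (PMBM.undetectedRate μ M lam0 f0 ≠ 0 →
      PMBM.IsProbDensity (PMBM.undetectedSpatial μ M f0) μ) := by
  refine ⟨⟨PMBM.exceptionalSet μ M f0 Z, PMBM.measure_exceptionalSet M hf0 Z, ?_,
    fun Θ hΘ => PMBM.posteriorDensity_eq_pmbmDensity M hlam0 hf0 hZpos hZfin hΘ⟩,
    ?_, ?_, ?_, ?_, ?_, ?_⟩
  · intro hC hu
    refine PMBM.exceptionalSet_eq_empty M hf0 fun C hCZ => ?_
    rcases C.eq_empty_or_nonempty with rfl | hne
    · rwa [← PMBM.undetectedMass_eq_cellMass]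
    · exact hC C hCZ hne
  · exact fun P => div_nonneg
      (Finset.prod_nonneg fun C _ => PMBM.cellLikelihood_nonneg M hlam0 hf0 C)
      (Finset.sum_nonneg fun Q _ =>
        Finset.prod_nonneg fun C _ => PMBM.cellLikelihood_nonneg M hlam0 hf0 C)
  · unfold PMBM.weight
    rw [← Finset.sum_div]
    exact div_self (PMBM.sum_prod_cellLikelihood_ne_zero M hlam0 hf0 hZpos hZfin)
  · intro C _ _
    have hL := PMBM.cellL_nonneg M hlam0 hf0 C
    have hc := PMBM.cellClutter_nonneg M C
    unfold PMBM.cellExistence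
    split_ifs
    · exact ⟨by positivity, div_le_one_of_le₀ (by linarith) (by positivity)⟩
    · exact ⟨zero_le_one, le_rfl⟩
  · intro P hW C hC hr
    refine PMBM.isProbDensity_cellSpatial M hf0 fun hm => ?_
    have hL : PMBM.cellL μ M lam0 f0 C = 0 := by rw [PMBM.cellL, hm, mul_zero]
    -- Zero mass gives existence probability `0` for a singleton cell, and weight `0` to the
    -- partition for a larger one.
    by_cases hcard : C.card = 1
    · exact hr (by rw [PMBM.cellExistence, if_pos hcard, hL, zero_div])
    · refine hW ?_
      rw [PMBM.weight, Finset.prod_eq_zero hC, zero_div]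
      rw [PMBM.cellLikelihood, if_neg hcard, hL]
  · rw [PMBM.undetectedRate_eq_cellL]
    exact PMBM.cellL_nonneg M hlam0 hf0 ∅
  · intro hu
    rw [PMBM.undetectedSpatial_eq_cellSpatial]
    refine PMBM.isProbDensity_cellSpatial M hf0 fun hm => hu ?_
    rw [PMBM.undetectedRate_eq_cellL, PMBM.cellL, hm, mul_zero]
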